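/- **Setting.** Let $X$ be a compact complex manifold of dimension $n$ and $L\to X$ a holomorphic line bundle with a smooth Hermitian metric $h_0$ (length $|\cdot|$) whose Chern form $\omega_0$ is positive definite; locally $\omega_0=dd^c(-\log|\sigma|)$ for a holomorphic frame $\sigma$ of $L$, with $dd^c=\frac{i}{\pi}\partial\bar\partial$. Distances and balls $B(x,r)$ in $X$ are those of the Riemannian metric induced by $\omega_0$, and Hölder continuity (with some exponent in $(0,1]$) refers to this distance. Let $\mathrm{PSH}(X,\omega_0)$ be the set of $\omega_0$-plurisubharmonic functions, i.e. functions $\psi\not\equiv-\infty$ on $X$ with values in $[-\infty,\infty)$ such that $\psi-\log|\sigma|$ is plurisubharmonic for local holomorphic frames $\sigma$ of $L$ (equivalently $dd^c\psi+\omega_0\ge 0$). Let $K\subset X$ be compact, $\phi$ a continuous real-valued function on $K$, $$\phi_K(z)=\sup\{\psi(z):\psi\in\mathrm{PSH}(X,\omega_0),\ \psi\le\phi\text{ on }K\}\qquad(z\in X),$$ and let $P_K\phi=\phi_K^*$ be the upper semicontinuous regularization of $\phi_K$. For $p\ge1$ and a section $s$ of $L^p=L^{\otimes p}$ put $|s|_{p\phi}=|s|e^{-p\phi}$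 on $K$, where $|s|$ is the length for $h_0^{\otimes p}$. **Theorem.** Let $\mu$ be a Borel probability measure on $K$, $W\subset K$ a compact set and $0<\delta<1$. Assume that $(K,\phi)$ is regular, i.e. $P_K\phi=\phi_K$, and that 1. $\phi$ is Hölder continuous on $K$, and $P_K\phi$ is real-valued and Hölder continuous on $X$; 2. $W$ satisfies the maximum principle relatively to $(K,\phi)$: $\sup_K(\psi-\phi)=\sup_W(\psi-\phi)$ for every $\psi\in\mathrm{PSH}(X,\omega_0)$; 3. $\mu$ satisfies the mass-density condition with respect to $W$: there are constants $c>0$ and $\rho>0$ with $\mu(B(x,r))\ge c\,r^\rho$ for all $x\in W$ and $0<r<1$. Then $\mu$ is $\delta$-Bernstein–Markov with respect to $(K,\phi)$: there is a constant $A>0$ such that for every integer $p\ge1$ and every holomorphic section $s$ of $L^p$, $$\sup_K|s|_{p\phi}\ \le\ A\,e^{A p^{1-\delta}}\Big(\int_K|s|_{p\phi}^2\,d\mu\Big)^{1/2}.$$ -/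

import Mathlib

open Set Filter Topology MeasureTheory Bundle
open scoped Manifold ContDiff ENNReal NNReal TensorProduct

/-- The model space `ℂⁿ` of a complex manifold of dimension `n`. -/
abbrev ComplexModel (n : ℕ) : Type := EuclideanSpace ℂ (Fin n)

section Plurisubharmonic

/-- The integral over `(0, 2π]` of a function `u` with values in `[-∞, ∞]`, as the difference of the
integrals of its positive and negative parts. It is used only for functions bounded above. -/
noncomputable def circleIntegralEReal (u : ℝ → EReal) : EReal :=
  ((∫⁻ θ in Ioc 0 (2 * Real.pi), (u θ).toENNReal : ℝ≥0∞) : EReal) -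
    ((∫⁻ θ in Ioc 0 (2 * Real.pi), (-u θ).toENNReal : ℝ≥0∞) : EReal)

/-- Plurisubharmonic functions on an open set `Ω` of a complex vector space: upper semicontinuous,
with values in `[-∞, ∞)`, and satisfying the sub-mean value inequality on every closed disc of a
complex line which is contained in `Ω`. -/
def PlurisubharmonicOn {E : Type*} [NormedAddCommGroup E] [NormedSpace ℂ E]
    (u : E → EReal) (Ω : Set E) : Prop :=
  UpperSemicontinuousOn u Ω ∧ (∀ z ∈ Ω, u z ≠ ⊤) ∧
    ∀ a v : E, (∀ ζ : ℂ, ‖ζ‖ ≤ 1 → a + ζ • v ∈ Ω) →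
      ((2 * Real.pi : ℝ) : EReal) * u a ≤
        circleIntegralEReal (fun θ => u (a + Complex.exp (θ * Complex.I) • v))

end Plurisubharmonic

section LineBundle

variable {n : ℕ} {X : Type*} [TopologicalSpace X] [ChartedSpace (ComplexModel n) X]
  {L : X → Type*} [TopologicalSpace (TotalSpace ℂ L)] [∀ x, TopologicalSpace (L x)]
  [∀ x, AddCommGroup (L x)] [∀ x, Module ℂ (L x)] [FiberBundle ℂ L] [VectorBundle ℂ ℂ L]

variable (L) in
/-- The local frame of the line bundle `L` near `x₀` given by the local trivialization at `x₀`. It is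
nowhere zero on `(trivializationAt ℂ L x₀).baseSet`, and it is holomorphic when `L` is. -/
noncomputable def localFrame (x₀ y : X) : L y := (trivializationAt ℂ L x₀).symm y 1

variable (n L) in
/-- A smooth Hermitian metric on the complex line bundle `L`, given by the lengths of the vectors. -/
structure SmoothHermitianMetric where
  /-- the length of a vector of a fibre -/
  len : ∀ x, L x → ℝ
  len_smul : ∀ x (c : ℂ) (v : L x), len x (c • v) = ‖c‖ * len x v
  len_pos : ∀ x (v : L x), v ≠ 0 → 0 < len x v
  smooth : ∀ x₀ : X, ContMDiffOn 𝓘(ℝ, ComplexModel n) 𝓘(ℝ, ℝ) ∞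
    (fun y => len y (localFrame L x₀ y)) (trivializationAt ℂ L x₀).baseSet

namespace SmoothHermitianMetric

variable (h : SmoothHermitianMetric n L)

/-- The local weight `-log |σ|` of the metric, where `σ` is the local frame near `x₀`. The Chern form
is `ω₀ = dd^c (-log |σ|)`, where `dd^c = (i/π) ∂∂̄`. -/
noncomputable def localWeight (x₀ y : X) : ℝ := -Real.log (h.len y (localFrame L x₀ y))

/-- The symmetric bilinear form `(v, w) ↦ ω₀(v, J w)` on the tangent space at `x`, where
`ω₀ = (i/π) ∂∂̄ u`, `u = -log |σ|`, is the Chern form of the metric. In a holomorphic coordinate it is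
`(1/2π) (D²u(v, w) + D²u(iv, iw))`; as for `TangentSpace`, tangent vectors at `x` are read in the
preferred chart at `x`. The Chern form itself is `ω₀(v, w) = chernMetric (i v) w`. -/
noncomputable def chernMetric (x : X) (v w : ComplexModel n) : ℝ :=
  let u : ComplexModel n → ℝ := fun z => h.localWeight x ((chartAt (ComplexModel n) x).symm z)
  let H := fderiv ℝ (fderiv ℝ u) (chartAt (ComplexModel n) x x)
  (1 / (2 * Real.pi)) * (H v w + H (Complex.I • v) (Complex.I • w))

/-- The metric is positively curved: its Chern form is positive definite (a Kähler form). -/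
def IsPositive : Prop := ∀ (x : X) (v : ComplexModel n), v ≠ 0 → 0 < h.chernMetric x v v

/-- The Riemannian distance on `X` associated with the Chern form `ω₀`: the infimum of the lengths of
the `C¹` paths, measured with the Riemannian metric `ω₀(·, J ·)`. (It is `∞` between different
components.) -/
noncomputable def rdist (x y : X) : ℝ≥0∞ :=
  letI : ∀ z : X, ENorm (TangentSpace 𝓘(ℝ, ComplexModel n) z) :=
    fun z => ⟨fun v => ENNReal.ofReal (Real.sqrt (h.chernMetric z v v))⟩
  Manifold.riemannianEDist 𝓘(ℝ, ComplexModel n) x y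

/-- The ball `B(x, r)` of `(X, ω₀)`. -/
def rball (x : X) (r : ℝ) : Set X := {y | h.rdist x y < ENNReal.ofReal r}

/-- `f` is Hölder continuous on the set `S`, for some exponent `0 < α ≤ 1`, with respect to the
Riemannian distance of `ω₀`. -/
def IsHolderOn (f : X → ℝ) (S : Set X) : Prop :=
  ∃ (C : ℝ≥0) (α : ℝ), 0 < α ∧ α ≤ 1 ∧
    ∀ x ∈ S, ∀ y ∈ S, edist (f x) (f y) ≤ C * h.rdist x y ^ α

/-- `ω₀`-plurisubharmonic functions `ψ : X → [-∞, ∞)`, that is `dd^c ψ + ω₀ ≥ 0`: for the local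
potentials `-log |σ|` of `ω₀`, the functions `ψ - log |σ|` are plurisubharmonic in the holomorphic
coordinates. The function `-∞` is excluded. (`X` is not assumed connected; functions equal to `-∞` on
some components only are harmless, as one may replace `ψ` by `max ψ (-C)` with `C` large.) -/
def IsOmegaPSH (ψ : X → EReal) : Prop :=
  (∃ x, ψ x ≠ ⊥) ∧ ∀ x₀ : X,
    PlurisubharmonicOn
      (fun z => ψ ((chartAt (ComplexModel n) x₀).symm z) +
        (h.localWeight x₀ ((chartAt (ComplexModel n) x₀).symm z) : EReal))
      ((chartAt (ComplexModel n) x₀).target ∩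
        (chartAt (ComplexModel n) x₀).symm ⁻¹' (trivializationAt ℂ L x₀).baseSet)

/-- The envelope `φ_K(z) = sup {ψ(z) : ψ ω₀-psh, ψ ≤ φ on K}`. -/
noncomputable def envelope (K : Set X) (φ : X → ℝ) (z : X) : EReal :=
  ⨆ ψ ∈ {ψ : X → EReal | h.IsOmegaPSH ψ ∧ ∀ x ∈ K, ψ x ≤ (φ x : EReal)}, ψ z

/-- The equilibrium weight `P_K φ = φ_K^*`, the upper semicontinuous regularization of `φ_K`. -/
noncomputable def equilibriumWeight (K : Set X) (φ : X → ℝ) (z : X) : EReal :=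
  limsup (h.envelope K φ) (𝓝 z)

/-- The weighted compact set `(K, φ)` is regular: `φ_K` is upper semicontinuous, i.e. `P_K φ = φ_K`. -/
def IsRegularPair (K : Set X) (φ : X → ℝ) : Prop :=
  ∀ z, h.equilibriumWeight K φ z = h.envelope K φ z

/-- `W` satisfies the maximum principle relatively to `(K, φ)`. -/
def SatisfiesMaxPrinciple (W K : Set X) (φ : X → ℝ) : Prop :=
  W ⊆ K ∧ ∀ ψ : X → EReal, h.IsOmegaPSH ψ →
    ⨆ x ∈ K, (ψ x - (φ x : EReal)) = ⨆ x ∈ W, (ψ x - (φ x : EReal))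

/-- The mass-density condition of a measure `μ` on `X` with respect to `W`. -/
def MassDensity [MeasurableSpace X] (μ : Measure X) (W : Set X) : Prop :=
  ∃ c ρ : ℝ, 0 < c ∧ 0 < ρ ∧ ∀ x ∈ W, ∀ r : ℝ, 0 < r → r < 1 →
    ENNReal.ofReal (c * r ^ ρ) ≤ μ (h.rball x r)

end SmoothHermitianMetric

/-- The linear form `v₁ ⊗ ⋯ ⊗ v_p ↦ ∏ (coordinate of vᵢ)` on the fibre of `L^p` at `y`, where the
coordinates are those given by the local trivialization of `L` at `x₀`. For `y` in the base set of the
trivialization, it is the coordinate with respect to the local frame `σ^{⊗p}`. -/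
noncomputable def powerCoord (x₀ y : X) (p : ℕ) : (⨂[ℂ]^p (L y)) →ₗ[ℂ] ℂ :=
  PiTensorProduct.lift ((MultilinearMap.mkPiAlgebra ℂ (Fin p) ℂ).compLinearMap
    (fun _ => (trivializationAt ℂ L x₀).linearMapAt ℂ y))

variable (n) in
/-- `s` is a holomorphic section of `L^p = L ⊗ ⋯ ⊗ L`: in each local trivialization,
`s = f σ^{⊗p}` with `f` holomorphic. -/
def IsHolomorphicSection (p : ℕ) (s : ∀ x, ⨂[ℂ]^p (L x)) : Prop :=
  ∀ x₀ : X, MDifferentiableOn 𝓘(ℂ, ComplexModel n) 𝓘(ℂ, ℂ)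
    (fun y => powerCoord x₀ y p (s y)) (trivializationAt ℂ L x₀).baseSet

namespace SmoothHermitianMetric

variable (h : SmoothHermitianMetric n L)

/-- The length of a vector of the fibre of `L^p` at `x` for the metric `h^{⊗p}`:
`|c σ^{⊗p}| = |c| |σ|^p`, where `σ` is the frame of `L` at `x`. -/
noncomputable def powerLen (p : ℕ) (x : X) (v : ⨂[ℂ]^p (L x)) : ℝ :=
  ‖powerCoord x x p v‖ * h.len x (localFrame L x x) ^ p

/-- `powerLen` is the metric induced by `h`: `|v₁ ⊗ ⋯ ⊗ v_p| = |v₁| ⋯ |v_p|`. -/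
theorem powerLen_tprod (p : ℕ) (x : X) (v : Fin p → L x) :
    h.powerLen p x (PiTensorProduct.tprod ℂ v) = ∏ i, h.len x (v i) := by
  have hx : x ∈ (trivializationAt ℂ L x).baseSet := FiberBundle.mem_baseSet_trivializationAt' x
  have key : ∀ w : L x, w = ((trivializationAt ℂ L x).linearMapAt ℂ x w) • localFrame L x x := by
    intro w
    have h1 := (trivializationAt ℂ L x).symmₗ_linearMapAt (R := ℂ) hx w
    have h2 : localFrame L x x = (trivializationAt ℂ L x).symmₗ ℂ x 1 := by
      rw [Trivialization.coe_symmₗ, localFrame]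
      exact hx
    rw [h2, ← map_smul, smul_eq_mul, mul_one, h1]
  have h3 : ∀ i, h.len x (v i) =
      ‖(trivializationAt ℂ L x).linearMapAt ℂ x (v i)‖ * h.len x (localFrame L x x) := by
    intro i
    conv_lhs => rw [key (v i)]
    rw [h.len_smul]
  simp only [powerLen, powerCoord, PiTensorProduct.lift.tprod, h3, Finset.prod_mul_distrib]
  simp [norm_prod]

/-- `|v|_{pφ} = e^{-pφ(x)} |v|` for `v` in the fibre of `L^p` at `x`. -/
noncomputable def weightedLen (p : ℕ) (φ : X → ℝ) (x : X) (v : ⨂[ℂ]^p (L x)) : ℝ :=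
  h.powerLen p x v * Real.exp (-(p * φ x))

/-- `‖s‖_{L^∞(K, pφ)} = sup_K |s|_{pφ}`. -/
noncomputable def supNorm (p : ℕ) (K : Set X) (φ : X → ℝ) (s : ∀ x, ⨂[ℂ]^p (L x)) : ℝ≥0∞ :=
  ⨆ x ∈ K, ENNReal.ofReal (h.weightedLen p φ x (s x))

/-- `‖s‖_{L²(μ, pφ)} = (∫ |s|²_{pφ} dμ)^{1/2}` for a measure `μ` on `K` and a weight `φ` on `K`. -/
noncomputable def l2Norm [MeasurableSpace X] (p : ℕ) (K : Set X) (φ : X → ℝ) (μ : Measure X)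
    (s : ∀ x, ⨂[ℂ]^p (L x)) : ℝ≥0∞ :=
  eLpNorm (fun x => h.weightedLen p φ x (s x)) 2 (μ.restrict K)

/-- `μ` is `δ`-Bernstein-Markov with respect to `(K, φ)`. -/
def IsBernsteinMarkov [MeasurableSpace X] (δ : ℝ) (K : Set X) (φ : X → ℝ) (μ : Measure X) : Prop :=
  ∃ A : ℝ, 0 < A ∧ ∀ p : ℕ, 1 ≤ p → ∀ s : ∀ x, ⨂[ℂ]^p (L x), IsHolomorphicSection n p s →
    h.supNorm p K φ s ≤
      ENNReal.ofReal (A * Real.exp (A * (p : ℝ) ^ (1 - δ))) * h.l2Norm p K φ μ s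

end SmoothHermitianMetric

end LineBundle

/-! Write `M` for the maximum over `K` of the weighted length of `s`, and `g` for the equilibrium
weight. The logarithm of the `p`-th root of `|s| / M` is ω₀-psh and at most `φ` on `K`, so it
competes in the envelope. Regularity identifies the envelope with `g`, whence `|s| ≤ M e^{pg}` on
all of `X` (`powerLen_le_exp_envelope`). The maximum principle applied to the same function gives a
point `x` of `W` where the weighted length is at least `M / 2` (`exists_half_le_weightedLen`).

This lower bound persists on a ball of radius comparable to `p ^ (-N)`. In a chart and frame, `s` is
a holomorphic function `F`. If `N` is at least the reciprocal of the Hölder exponents, then `p`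
times the oscillation of `g`, of `φ` (along `K`) and of the local weight stays bounded at that
scale. Hence `|F|` is at most a constant times its size at `x`, and the Schwarz lemma prevents it
from dropping much on a small fixed fraction of the ball (`exists_weightedLen_lower_bound_near`).
Compactness makes the constants uniform.

Mass-density then bounds the squared norm below by a constant times `M ^ 2 * p ^ (-N * ρ)`. So `M`
exceeds the norm by at most a polynomial factor in `p`, which `exp (A * p ^ (1 - δ))` absorbs.

Balls are Riemannian, while Schwarz works in charts. The two distances are comparable because the
Chern form, which is independent of chart and frame, is positive and continuous
(`exists_chart_comparison`). -/

/-! ### The Levi form: holomorphic invariance and local bounds -/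

section LeviForm

variable {E E' : Type*} [NormedAddCommGroup E] [NormedSpace ℂ E]
  [NormedAddCommGroup E'] [NormedSpace ℂ E']

/-- The Levi form `D²u(v, v) + D²u(iv, iv)` of a real function `u` on a complex vector space. -/
noncomputable def leviForm (u : E → ℝ) (a v : E) : ℝ :=
  fderiv ℝ (fderiv ℝ u) a v v + fderiv ℝ (fderiv ℝ u) a (Complex.I • v) (Complex.I • v)

theorem Filter.EventuallyEq.leviForm_eq {u w : E → ℝ} {a : E} (h : u =ᶠ[𝓝 a] w) (v : E) :
    leviForm u a v = leviForm w a v := by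
  have : fderiv ℝ (fderiv ℝ u) a = fderiv ℝ (fderiv ℝ w) a := by
    apply Filter.EventuallyEq.fderiv_eq
    exact h.fderiv
  simp only [leviForm, this]

theorem ContDiffAt.differentiableAt_fderiv_real {F : Type*} [NormedAddCommGroup F] [NormedSpace ℝ F]
    {u : E → F} {a : E} (hu : ContDiffAt ℝ 2 u a) : DifferentiableAt ℝ (fderiv ℝ u) a :=
  (hu.fderiv_right (m := 1) (by norm_num)).differentiableAt (by norm_num)

theorem leviForm_sub {u w : E → ℝ} {a : E} (hu : ContDiffAt ℝ 2 u a) (hw : ContDiffAt ℝ 2 w a)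
    (v : E) : leviForm (fun x => u x - w x) a v = leviForm u a v - leviForm w a v := by
  have h1 : fderiv ℝ (fun x => u x - w x) =ᶠ[𝓝 a] fun x => fderiv ℝ u x - fderiv ℝ w x := by
    filter_upwards [hu.eventually (by simp), hw.eventually (by simp)] with x hx hx'
    exact fderiv_fun_sub (hx.differentiableAt (by norm_num)) (hx'.differentiableAt (by norm_num))
  have h2 : fderiv ℝ (fderiv ℝ (fun x => u x - w x)) a =
      fderiv ℝ (fderiv ℝ u) a - fderiv ℝ (fderiv ℝ w) a := by
    rw [h1.fderiv_eq]
    exact fderiv_fun_sub hu.differentiableAt_fderiv_real hw.differentiableAt_fderiv_real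
  simp only [leviForm, h2, sub_apply]
  ring

/-- The second real derivative of a holomorphic map is complex bilinear. -/
theorem fderiv_fderiv_restrictScalars_apply {F : E → E'} {a : E} (hF : ContDiffAt ℂ 2 F a)
    (v w : E) : fderiv ℝ (fderiv ℝ F) a v w = fderiv ℂ (fderiv ℂ F) a v w := by
  have h1 : fderiv ℝ F =ᶠ[𝓝 a] fun x =>
      ContinuousLinearMap.restrictScalarsL ℂ E E' ℝ ℝ (fderiv ℂ F x) := by
    filter_upwards [hF.eventually (by simp)] with x hx
    exact (hx.differentiableAt (by norm_num)).fderiv_restrictScalars ℝ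
  have h2 : DifferentiableAt ℂ (fderiv ℂ F) a :=
    (hF.fderiv_right (m := 1) (by norm_num)).differentiableAt (by norm_num)
  have h3 := (ContinuousLinearMap.restrictScalarsL ℂ E E' ℝ ℝ).hasFDerivAt.comp a
    (h2.hasFDerivAt.restrictScalars ℝ)
  rw [h1.fderiv_eq]
  erw [h3.fderiv]
  rfl

/-- The chain rule leaves an extra term, `Du` applied to `D²F(v, v)`. Since `D²F` is complex
bilinear, its values at `v` and `iv` are opposite, so this term cancels in the Levi form. -/
theorem leviForm_comp {F : E → E'} {u : E' → ℝ} {a : E} (hF : ContDiffAt ℂ 2 F a)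
    (hu : ContDiffAt ℝ 2 u (F a)) (v : E) :
    leviForm (u ∘ F) a v = leviForm u (F a) (fderiv ℝ F a v) := by
  have hFr : ContDiffAt ℝ 2 F a := hF.restrict_scalars ℝ
  have h1 : fderiv ℝ (u ∘ F) =ᶠ[𝓝 a] fun x => (fderiv ℝ u (F x)).comp (fderiv ℝ F x) := by
    filter_upwards [hFr.eventually (by simp),
      hFr.continuousAt.eventually (hu.eventually (by simp))] with x hx hx'
    exact fderiv_comp x (hx'.differentiableAt (by norm_num)) (hx.differentiableAt (by norm_num))
  have h2 := hu.differentiableAt_fderiv_real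
  have h3 := hFr.differentiableAt_fderiv_real
  have h4 : HasFDerivAt (fun x => fderiv ℝ u (F x)) _ a :=
    h2.hasFDerivAt.comp a (hFr.differentiableAt (by norm_num)).hasFDerivAt
  have h5 := h4.clm_comp h3.hasFDerivAt
  have h6 : ∀ w, fderiv ℝ (fderiv ℝ (u ∘ F)) a w w =
      fderiv ℝ (fderiv ℝ u) (F a) (fderiv ℝ F a w) (fderiv ℝ F a w) +
        fderiv ℝ u (F a) (fderiv ℝ (fderiv ℝ F) a w w) := by
    intro w
    rw [h1.fderiv_eq, h5.fderiv]
    simp [add_comm]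
  have h7 : ∀ w, fderiv ℝ F a (Complex.I • w) = Complex.I • fderiv ℝ F a w := by
    intro w
    rw [(hF.differentiableAt (by norm_num)).fderiv_restrictScalars ℝ]
    simp
  have h8 : fderiv ℝ (fderiv ℝ F) a (Complex.I • v) (Complex.I • v) =
      -fderiv ℝ (fderiv ℝ F) a v v := by
    simp only [fderiv_fderiv_restrictScalars_apply hF, map_smul, smul_apply,
      smul_smul, Complex.I_mul_I, neg_smul, one_smul]
  simp only [leviForm, h6, h7, h8, map_neg]
  ring

/-- The logarithm of the modulus of a holomorphic function is pluriharmonic. -/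
theorem contDiffAt_log_norm_and_leviForm_eq_zero {g : E → ℂ} {a : E} (hg : ContDiffAt ℂ 2 g a)
    (h0 : g a ≠ 0) :
    ContDiffAt ℝ 2 (fun x => Real.log ‖g x‖) a ∧
      ∀ v, leviForm (fun x => Real.log ‖g x‖) a v = 0 := by
  -- Dividing by `g a` moves the value at `a` to `1`, away from the branch cut; `log |g|` is then a
  -- constant plus the real part of a holomorphic function.
  set G : E → ℂ := fun x => Complex.log ((g a)⁻¹ * g x) with hG
  have hG1 : ContDiffAt ℂ 2 G a :=
    (Complex.contDiffAt_log (by rw [inv_mul_cancel₀ h0]; exact Complex.one_mem_slitPlane)).comp a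
      (contDiffAt_const.mul hg)
  set r : ℂ → ℝ := fun z => Real.log ‖g a‖ + Complex.reCLM z with hr
  have hr1 : ContDiff ℝ 2 r := contDiff_const.add Complex.reCLM.contDiff
  have hr2 : ∀ z v, leviForm r z v = 0 := by
    intro z v
    have : fderiv ℝ r = fun _ => Complex.reCLM := by
      ext1 x
      rw [hr, fderiv_const_add, Complex.reCLM.fderiv]
    simp [leviForm, this]
  have he : (fun x => Real.log ‖g x‖) =ᶠ[𝓝 a] r ∘ G := by
    filter_upwards [hg.continuousAt.eventually_ne h0] with x hx
    simp only [hr, hG, Function.comp, Complex.reCLM_apply, Complex.log_re, norm_mul, norm_inv]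
    rw [Real.log_mul (by simpa using h0) (by simpa using hx), Real.log_inv]
    ring
  refine ⟨?_, fun v => ?_⟩
  · exact (hr1.contDiffAt.comp a (hG1.restrict_scalars ℝ)).congr_of_eventuallyEq he
  · rw [he.leviForm_eq, leviForm_comp hG1 hr1.contDiffAt, hr2]

theorem leviForm_smul (u : E → ℝ) (a v : E) (t : ℝ) :
    leviForm u a (t • v) = t ^ 2 * leviForm u a v := by
  simp only [leviForm, smul_comm Complex.I t v, map_smul, smul_apply,
    smul_eq_mul]
  ring

theorem continuousAt_leviForm {u : E → ℝ} {a : E} (hu : ContDiffAt ℝ 2 u a) (v : E) :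
    ContinuousAt (fun p : E × E => leviForm u p.1 p.2) (a, v) := by
  have h1 : ContinuousAt (fderiv ℝ (fderiv ℝ u)) a :=
    ((hu.fderiv_right (m := 1) (by norm_num)).fderiv_right (m := 0) (by norm_num)).continuousAt
  have h2 : ContinuousAt (fun p : E × E => fderiv ℝ (fderiv ℝ u) p.1) (a, v) :=
    ContinuousAt.comp (f := Prod.fst) h1 continuousAt_fst
  exact ((h2.clm_apply continuousAt_snd).clm_apply continuousAt_snd).add
    ((h2.clm_apply (continuousAt_snd.const_smul _)).clm_apply (continuousAt_snd.const_smul _))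

/-- A positive definite Levi form is uniformly comparable to the square of the norm near a point. -/
theorem exists_eventually_leviForm_bounds [FiniteDimensional ℂ E] {u : E → ℝ} {a : E}
    (hu : ContDiffAt ℝ 2 u a) (hpos : ∀ v, v ≠ 0 → 0 < leviForm u a v) :
    ∃ C : ℝ, 0 < C ∧ ∀ᶠ y in 𝓝 a, ∀ v,
      leviForm u y v ≤ C * ‖v‖ ^ 2 ∧ ‖v‖ ^ 2 ≤ C * leviForm u y v := by
  have : ProperSpace E := FiniteDimensional.proper ℂ E
  have hS : IsCompact (Metric.sphere (0 : E) 1) := isCompact_sphere 0 1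
  have key : ∃ C : ℝ, 0 < C ∧ ∀ᶠ y in 𝓝 a, ∀ v ∈ Metric.sphere (0 : E) 1,
      leviForm u y v ≤ C ∧ 1 ≤ C * leviForm u y v := by
    -- Compactness of the sphere makes both the constant and the neighbourhood of `a` uniform in the
    -- direction `v`. Homogeneity of degree two covers the other vectors.
    refine hS.induction_on (p := fun S => ∃ C : ℝ, 0 < C ∧ ∀ᶠ y in 𝓝 a, ∀ v ∈ S,
      leviForm u y v ≤ C ∧ 1 ≤ C * leviForm u y v) ⟨1, one_pos, by simp⟩ ?_ ?_ ?_
    · rintro s t hst ⟨C, hC, h⟩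
      exact ⟨C, hC, h.mono fun y hy v hv => hy v (hst hv)⟩
    · rintro s t ⟨C, hC, h⟩ ⟨C', hC', h'⟩
      refine ⟨C + C', by positivity, ?_⟩
      filter_upwards [h, h'] with y hy hy' v hv
      rcases hv with hv | hv
      · have := hy v hv
        have : 0 < leviForm u y v := by
          by_contra hcon
          nlinarith
        exact ⟨by linarith, by nlinarith⟩
      · have := hy' v hv
        have : 0 < leviForm u y v := by
          by_contra hcon
          nlinarith
        exact ⟨by linarith, by nlinarith⟩
    · intro v hv
      have hv0 : v ≠ 0 := by
        rintro rfl
        simp at hv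
      have hp := hpos v hv0
      set q := leviForm u a v
      have hc := continuousAt_leviForm hu v
      have h1 := hc.eventually (Ioo_mem_nhds (show q / 2 < q by linarith) (show q < 2 * q by linarith))
      rw [nhds_prod_eq] at h1
      obtain ⟨A, hA, B, hB, hAB⟩ := eventually_prod_iff.1 h1
      -- Near `(a, v)` the form lies between `q / 2` and `2 * q`: the summand `2 * q` gives the
      -- upper bound and `2 / q` the lower one.
      refine ⟨{v | B v}, mem_nhdsWithin_of_mem_nhds hB, 2 * q + 2 / q, by positivity, ?_⟩
      filter_upwards [hA] with y hy w hw
      have h2 : _ ∧ _ := hAB hy hw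
      refine ⟨?_, ?_⟩
      · have : 0 < 2 / q := by positivity
        linarith [h2.2]
      · have h3 : 1 = 2 / q * (q / 2) := by field_simp
        have : 0 < 2 / q := by positivity
        nlinarith [h2.1]
  obtain ⟨C, hC, h⟩ := key
  refine ⟨C, hC, h.mono fun y hy v => ?_⟩
  rcases eq_or_ne v 0 with rfl | hv
  · simp [leviForm]
  · have hn : 0 < ‖v‖ := norm_pos_iff.2 hv
    have h1 := hy (‖v‖⁻¹ • v) (by simp [norm_smul, hn.ne'])
    rw [leviForm_smul] at h1
    have h2 : ‖v‖ ^ 2 * (‖v‖⁻¹ ^ 2 * leviForm u y v) = leviForm u y v := by field_simp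
    have h3 : 0 < ‖v‖ ^ 2 := by positivity
    refine ⟨?_, ?_⟩
    · nlinarith [h1.1]
    · nlinarith [h1.2]

end LeviForm

/-! ### Transition maps and the underlying real manifold -/

section ComplexManifold

variable {n : ℕ} {X : Type*} [TopologicalSpace X] [ChartedSpace (ComplexModel n) X]

theorem contDiffAt_chart_comp_symm [IsManifold 𝓘(ℂ, ComplexModel n) ω X] (x₀ x₁ : X) {y : X}
    (h₀ : y ∈ (chartAt (ComplexModel n) x₀).source)
    (h₁ : y ∈ (chartAt (ComplexModel n) x₁).source) :
    ContDiffAt ℂ ω (chartAt (ComplexModel n) x₀ ∘ (chartAt (ComplexModel n) x₁).symm)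
      (chartAt (ComplexModel n) x₁ y) := by
  have h := (mem_groupoid_of_pregroupoid.1
    (HasGroupoid.compatible (G := contDiffGroupoid ω 𝓘(ℂ, ComplexModel n))
      (chart_mem_atlas (ComplexModel n) x₁) (chart_mem_atlas (ComplexModel n) x₀))).1
  have h' : ContDiffOn ℂ ω (chartAt (ComplexModel n) x₀ ∘ (chartAt (ComplexModel n) x₁).symm)
      ((chartAt (ComplexModel n) x₁).symm.trans (chartAt (ComplexModel n) x₀)).source := by
    simpa [contDiffPregroupoid] using h
  refine h'.contDiffAt (OpenPartialHomeomorph.open_source _ |>.mem_nhds ?_)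
  simp [h₀, h₁]

theorem isManifold_real_of_complex [IsManifold 𝓘(ℂ, ComplexModel n) ω X] :
    IsManifold 𝓘(ℝ, ComplexModel n) ω X := by
  refine isManifold_of_contDiffOn _ _ _ fun e e' he he' => ?_
  have h := (mem_groupoid_of_pregroupoid.1
    (HasGroupoid.compatible (G := contDiffGroupoid ω 𝓘(ℂ, ComplexModel n)) he he')).1
  simpa using h.restrict_scalars ℝ

end ComplexManifold

/-! ### Change of frame and the Chern form near a point -/

section LineBundle

variable {n : ℕ} {X : Type*} [TopologicalSpace X] [ChartedSpace (ComplexModel n) X]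
  {L : X → Type*} [TopologicalSpace (TotalSpace ℂ L)] [∀ x, TopologicalSpace (L x)]
  [∀ x, AddCommGroup (L x)] [∀ x, Module ℂ (L x)] [FiberBundle ℂ L] [VectorBundle ℂ ℂ L]

variable (L) in
/-- The coordinate of the local frame near `x₁` with respect to the local frame near `x₀`. -/
noncomputable def frameRatio (x₁ x₀ y : X) : ℂ :=
  (trivializationAt ℂ L x₀).linearMapAt ℂ y (localFrame L x₁ y)

theorem linearMapAt_localFrame_self {x₀ y : X} (hy : y ∈ (trivializationAt ℂ L x₀).baseSet) :
    (trivializationAt ℂ L x₀).linearMapAt ℂ y (localFrame L x₀ y) = 1 := by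
  have h := (trivializationAt ℂ L x₀).linearMapAt_symmₗ (R := ℂ) hy 1
  rwa [Trivialization.coe_symmₗ _ hy] at h

theorem linearMapAt_smul_localFrame {x₀ y : X} (hy : y ∈ (trivializationAt ℂ L x₀).baseSet)
    (v : L y) : (trivializationAt ℂ L x₀).linearMapAt ℂ y v • localFrame L x₀ y = v := by
  have h := (trivializationAt ℂ L x₀).symmₗ_linearMapAt (R := ℂ) hy v
  rw [Trivialization.coe_symmₗ _ hy] at h
  conv_rhs => rw [← h]
  have h2 := (trivializationAt ℂ L x₀).symmₗ ℂ y |>.map_smul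
    ((trivializationAt ℂ L x₀).linearMapAt ℂ y v) 1
  rw [Trivialization.coe_symmₗ _ hy, smul_eq_mul, mul_one] at h2
  exact h2.symm

theorem localFrame_eq_smul {x₁ x₀ y : X} (hy : y ∈ (trivializationAt ℂ L x₀).baseSet) :
    localFrame L x₁ y = frameRatio L x₁ x₀ y • localFrame L x₀ y :=
  (linearMapAt_smul_localFrame hy _).symm

theorem localFrame_ne_zero {x₀ y : X} (hy : y ∈ (trivializationAt ℂ L x₀).baseSet) :
    localFrame L x₀ y ≠ 0 := by
  intro h
  have := linearMapAt_localFrame_self hy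
  simp [h] at this

theorem frameRatio_ne_zero {x₁ x₀ y : X} (hy₁ : y ∈ (trivializationAt ℂ L x₁).baseSet)
    (hy : y ∈ (trivializationAt ℂ L x₀).baseSet) : frameRatio L x₁ x₀ y ≠ 0 := by
  intro h
  have := localFrame_eq_smul (x₁ := x₁) hy
  rw [h, zero_smul] at this
  exact localFrame_ne_zero hy₁ this

theorem contMDiffAt_frameRatio [ContMDiffVectorBundle ω ℂ L 𝓘(ℂ, ComplexModel n)]
    {x₁ x₀ y : X} (hy₁ : y ∈ (trivializationAt ℂ L x₁).baseSet)
    (hy : y ∈ (trivializationAt ℂ L x₀).baseSet) :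
    ContMDiffAt 𝓘(ℂ, ComplexModel n) 𝓘(ℂ, ℂ) ω (frameRatio L x₁ x₀) y := by
  have h := contMDiffAt_coordChangeL (n := ω) (IB := 𝓘(ℂ, ComplexModel n)) hy₁ hy
  have h2 := h.clm_apply (contMDiffAt_const (c := (1 : ℂ)))
  refine h2.congr_of_eventuallyEq ?_
  filter_upwards [(trivializationAt ℂ L x₁).open_baseSet.mem_nhds hy₁,
    (trivializationAt ℂ L x₀).open_baseSet.mem_nhds hy] with z hz hz'
  rw [frameRatio, localFrame]
  simp only [ContinuousLinearEquiv.coe_coe]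
  rw [Trivialization.coordChangeL_apply _ _ ⟨hz, hz'⟩, Trivialization.coe_linearMapAt_of_mem _ hz']

namespace SmoothHermitianMetric

variable (h : SmoothHermitianMetric n L)

theorem len_localFrame_pos {x₀ y : X} (hy : y ∈ (trivializationAt ℂ L x₀).baseSet) :
    0 < h.len y (localFrame L x₀ y) := h.len_pos _ _ (localFrame_ne_zero hy)

/-- The correction is the log-modulus of a nonvanishing holomorphic function in the bundle's
holomorphic structure, hence pluriharmonic. This is why the Chern form does not depend on the frame.
-/
theorem localWeight_eq_sub {x₁ x₀ y : X} (hy₁ : y ∈ (trivializationAt ℂ L x₁).baseSet)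
    (hy : y ∈ (trivializationAt ℂ L x₀).baseSet) :
    h.localWeight x₁ y = h.localWeight x₀ y - Real.log ‖frameRatio L x₁ x₀ y‖ := by
  rw [localWeight, localWeight, localFrame_eq_smul (x₁ := x₁) hy, h.len_smul,
    Real.log_mul (norm_ne_zero_iff.2 (frameRatio_ne_zero hy₁ hy)) (h.len_localFrame_pos hy).ne']
  ring

theorem contMDiffAt_localWeight {x₀ y : X} (hy : y ∈ (trivializationAt ℂ L x₀).baseSet) :
    ContMDiffAt 𝓘(ℝ, ComplexModel n) 𝓘(ℝ, ℝ) ∞ (h.localWeight x₀) y := by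
  have h1 := (h.smooth x₀).contMDiffAt ((trivializationAt ℂ L x₀).open_baseSet.mem_nhds hy)
  have h2 : ContDiffAt ℝ ∞ (fun t => -Real.log t) (h.len y (localFrame L x₀ y)) :=
    (Real.contDiffAt_log.2 (h.len_localFrame_pos hy).ne').neg
  exact ContMDiffAt.comp (g := fun t => -Real.log t) y h2.contMDiffAt h1

theorem contDiffAt_localWeight_comp_symm [IsManifold 𝓘(ℂ, ComplexModel n) ω X] {x₀ x₁ y : X}
    (hy : y ∈ (trivializationAt ℂ L x₀).baseSet)
    (hy₁ : y ∈ (chartAt (ComplexModel n) x₁).source) :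
    ContDiffAt ℝ ∞ (fun z => h.localWeight x₀ ((chartAt (ComplexModel n) x₁).symm z))
      (chartAt (ComplexModel n) x₁ y) := by
  have : IsManifold 𝓘(ℝ, ComplexModel n) ω X := isManifold_real_of_complex
  have h1 : ContMDiffAt 𝓘(ℝ, ComplexModel n) 𝓘(ℝ, ComplexModel n) ∞
      (chartAt (ComplexModel n) x₁).symm (chartAt (ComplexModel n) x₁ y) :=
    (contMDiffOn_chart_symm (I := 𝓘(ℝ, ComplexModel n)) (n := ∞)).contMDiffAt
      ((chartAt (ComplexModel n) x₁).open_target.mem_nhds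
        ((chartAt (ComplexModel n) x₁).map_source hy₁))
  have h2 : ContMDiffAt 𝓘(ℝ, ComplexModel n) 𝓘(ℝ, ℝ) ∞ (h.localWeight x₀)
      ((chartAt (ComplexModel n) x₁).symm (chartAt (ComplexModel n) x₁ y)) := by
    rw [(chartAt (ComplexModel n) x₁).left_inv hy₁]
    exact h.contMDiffAt_localWeight hy
  exact (h2.comp _ h1).contDiffAt

/-- The Levi form defining the metric may be computed in any holomorphic chart and frame. -/
theorem chernMetric_eq_leviForm [IsManifold 𝓘(ℂ, ComplexModel n) ω X]
    [ContMDiffVectorBundle ω ℂ L 𝓘(ℂ, ComplexModel n)] {x₀ y : X}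
    (hy : y ∈ (trivializationAt ℂ L x₀).baseSet)
    (hy₀ : y ∈ (chartAt (ComplexModel n) x₀).source) (v : ComplexModel n) :
    h.chernMetric y v v = 1 / (2 * Real.pi) *
      leviForm (fun z => h.localWeight x₀ ((chartAt (ComplexModel n) x₀).symm z))
        (chartAt (ComplexModel n) x₀ y)
        (fderiv ℝ (chartAt (ComplexModel n) x₀ ∘ (chartAt (ComplexModel n) y).symm)
          (chartAt (ComplexModel n) y y) v) := by
  set e₀ := chartAt (ComplexModel n) x₀
  set e := chartAt (ComplexModel n) y with he
  have hys : y ∈ e.source := mem_chart_source _ y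
  have hyb : y ∈ (trivializationAt ℂ L y).baseSet := FiberBundle.mem_baseSet_trivializationAt' y
  have hey : e.symm (e y) = y := e.left_inv hys
  have hF : ContDiffAt ℂ 2 (e₀ ∘ e.symm) (e y) :=
    (contDiffAt_chart_comp_symm x₀ y hy₀ hys).of_le le_top
  have hFy : (e₀ ∘ e.symm) (e y) = e₀ y := by simp [hey]
  set u : ComplexModel n → ℝ := fun z => h.localWeight x₀ (e₀.symm z)
  have hu : ContDiffAt ℝ 2 u ((e₀ ∘ e.symm) (e y)) := by
    rw [hFy]
    exact (h.contDiffAt_localWeight_comp_symm hy hy₀).of_le ENat.LEInfty.out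
  have hg : ContDiffAt ℂ 2 (fun z => frameRatio L y x₀ (e.symm z)) (e y) := by
    have h1 : ContMDiffAt 𝓘(ℂ, ComplexModel n) 𝓘(ℂ, ComplexModel n) ω e.symm (e y) :=
      (contMDiffOn_chart_symm (I := 𝓘(ℂ, ComplexModel n)) (n := ω)).contMDiffAt
        (e.open_target.mem_nhds (e.map_source hys))
    have h2 : ContMDiffAt 𝓘(ℂ, ComplexModel n) 𝓘(ℂ, ℂ) ω (frameRatio L y x₀) (e.symm (e y)) := by
      rw [hey]
      exact contMDiffAt_frameRatio hyb hy
    exact ((h2.comp _ h1).contDiffAt).of_le le_top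
  obtain ⟨hl1, hl2⟩ := contDiffAt_log_norm_and_leviForm_eq_zero hg
    (by rw [hey]; exact frameRatio_ne_zero hyb hy)
  have heq : (fun z => h.localWeight y (e.symm z)) =ᶠ[𝓝 (e y)]
      fun z => (u ∘ (e₀ ∘ e.symm)) z - Real.log ‖frameRatio L y x₀ (e.symm z)‖ := by
    have hc : ContinuousAt e.symm (e y) := e.symm.continuousAt (by simpa using e.map_source hys)
    have h1 : (trivializationAt ℂ L y).baseSet ∩ (trivializationAt ℂ L x₀).baseSet ∩ e₀.source
        ∈ 𝓝 (e.symm (e y)) := by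
      rw [hey]
      exact ((((trivializationAt ℂ L y).open_baseSet.inter
        (trivializationAt ℂ L x₀).open_baseSet).inter e₀.open_source).mem_nhds ⟨⟨hyb, hy⟩, hy₀⟩)
    filter_upwards [hc h1] with z hz
    obtain ⟨⟨hz1, hz2⟩, hz3⟩ := hz
    simp only [u, Function.comp]
    rw [h.localWeight_eq_sub hz1 hz2, e₀.left_inv hz3]
  change 1 / (2 * Real.pi) * leviForm (fun z => h.localWeight y (e.symm z)) (e y) v = _
  rw [heq.leviForm_eq, leviForm_sub (hu.comp _ (hF.restrict_scalars ℝ)) hl1, hl2, sub_zero,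
    leviForm_comp hF hu, hFy]

/-- The metric at `y` is defined in the chart and frame at `y`, which vary with no continuity in
`y`. Invariance of the Levi form moves everything to the chart and frame at `x₀`; the derivative of
the transition map carries the tangent vector there. -/
theorem exists_eventually_chernMetric_bounds [IsManifold 𝓘(ℂ, ComplexModel n) ω X]
    [ContMDiffVectorBundle ω ℂ L 𝓘(ℂ, ComplexModel n)] (hpos : h.IsPositive) (x₀ : X) :
    ∃ C : ℝ≥0, 0 < C ∧ ∀ᶠ y in 𝓝 x₀, ∀ v : ComplexModel n,
      ‖fderiv ℝ (chartAt (ComplexModel n) x₀ ∘ (chartAt (ComplexModel n) y).symm)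
          (chartAt (ComplexModel n) y y) v‖ₑ ≤
        C * ENNReal.ofReal (Real.sqrt (h.chernMetric y v v)) ∧
      ENNReal.ofReal (Real.sqrt (h.chernMetric y v v)) ≤
        C * ‖fderiv ℝ (chartAt (ComplexModel n) x₀ ∘ (chartAt (ComplexModel n) y).symm)
          (chartAt (ComplexModel n) y y) v‖ₑ := by
  have hxs := mem_chart_source (ComplexModel n) x₀
  have hxb : x₀ ∈ (trivializationAt ℂ L x₀).baseSet := FiberBundle.mem_baseSet_trivializationAt' x₀
  have hpi := Real.pi_pos
  obtain ⟨C, hC, hb⟩ := exists_eventually_leviForm_bounds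
    (u := fun z => h.localWeight x₀ ((chartAt (ComplexModel n) x₀).symm z))
    (a := chartAt (ComplexModel n) x₀ x₀)
    ((h.contDiffAt_localWeight_comp_symm hxb hxs).of_le ENat.LEInfty.out) (by
      intro v hv
      have h1 : 0 < 1 / (2 * Real.pi) * leviForm _ _ v := hpos x₀ v hv
      exact pos_of_mul_pos_right h1 (by positivity))
  have hc : ContinuousAt (chartAt (ComplexModel n) x₀) x₀ :=
    (chartAt (ComplexModel n) x₀).continuousAt hxs
  -- The two summands handle the two inequalities between squared lengths, including the factor `1 /
  -- (2π)`; lengths then compare with constant `√D`.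
  set D : ℝ := C * (2 * Real.pi) + C * (1 / (2 * Real.pi)) with hD
  have hD0 : 0 < D := by positivity
  refine ⟨NNReal.mk (Real.sqrt D) (Real.sqrt_nonneg _), Real.sqrt_pos.2 hD0, ?_⟩
  filter_upwards [hc.eventually hb, (chartAt (ComplexModel n) x₀).open_source.mem_nhds hxs,
    (trivializationAt ℂ L x₀).open_baseSet.mem_nhds hxb] with y hy hys hyb v
  rw [h.chernMetric_eq_leviForm hyb hys]
  set w := fderiv ℝ (chartAt (ComplexModel n) x₀ ∘ (chartAt (ComplexModel n) y).symm)
          (chartAt (ComplexModel n) y y) v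
  obtain ⟨h1, h2⟩ := hy w
  set q := leviForm (fun z => h.localWeight x₀ ((chartAt (ComplexModel n) x₀).symm z))
    (chartAt (ComplexModel n) x₀ y) w
  have hq : 0 ≤ q := nonneg_of_mul_nonneg_right (le_trans (sq_nonneg _) h2) hC
  have e1 : ((NNReal.mk (Real.sqrt D) (Real.sqrt_nonneg _) : ℝ≥0) : ℝ≥0∞) = ENNReal.ofReal (Real.sqrt D) := by
    rw [ENNReal.ofReal, Real.toNNReal_of_nonneg (Real.sqrt_nonneg _)]
  have e2 : ‖w‖ₑ = ENNReal.ofReal (Real.sqrt (‖w‖ ^ 2)) := by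
    rw [Real.sqrt_sq (norm_nonneg _), ofReal_norm]
  rw [e1, e2, ← ENNReal.ofReal_mul (Real.sqrt_nonneg _), ← ENNReal.ofReal_mul (Real.sqrt_nonneg _),
    ← Real.sqrt_mul hD0.le, ← Real.sqrt_mul hD0.le]
  constructor
  · refine ENNReal.ofReal_le_ofReal (Real.sqrt_le_sqrt ?_)
    have : D * (1 / (2 * Real.pi) * q) = C * q + C * (1 / (2 * Real.pi)) * (1 / (2 * Real.pi)) * q := by
      rw [hD]; field_simp
    have : 0 ≤ C * (1 / (2 * Real.pi)) * (1 / (2 * Real.pi)) * q := by positivity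
    linarith
  · refine ENNReal.ofReal_le_ofReal (Real.sqrt_le_sqrt ?_)
    have h3 : 1 / (2 * Real.pi) * q ≤ 1 / (2 * Real.pi) * (C * ‖w‖ ^ 2) := by gcongr
    have : 0 ≤ C * (2 * Real.pi) * ‖w‖ ^ 2 := by positivity
    rw [hD]
    linarith

end SmoothHermitianMetric

end LineBundle

/-! ### Riemannian distance against distance in a chart -/

section ChartDistance

variable {E : Type*} [NormedAddCommGroup E] [NormedSpace ℝ E]
  {M : Type*} [TopologicalSpace M] [ChartedSpace E M] [IsManifold 𝓘(ℝ, E) 1 M]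

theorem mfderiv_chartAt_eq_fderiv {x₀ z : M} (hz : z ∈ (chartAt E x₀).source) :
    mfderiv 𝓘(ℝ, E) 𝓘(ℝ, E) (chartAt E x₀) z =
      fderiv ℝ (chartAt E x₀ ∘ (chartAt E z).symm) (chartAt E z z) := by
  have h : MDifferentiableAt 𝓘(ℝ, E) 𝓘(ℝ, E) (chartAt E x₀) z :=
    mdifferentiableAt_atlas (chart_mem_atlas E x₀) hz
  rw [h.mfderiv]
  simp only [writtenInExtChartAt, mfld_simps, fderivWithin_univ]
  rfl

variable [∀ z : M, ENorm (TangentSpace 𝓘(ℝ, E) z)]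
  [∀ z : M, ENormSMulClass ℝ (TangentSpace 𝓘(ℝ, E) z)]

/-- If the tangent norms are bounded by the norm in a chart, then the Riemannian distance is bounded
by the distance in the chart on convex sets. -/
theorem riemannianEDist_chartAt_symm_le {x₀ : M} {C : ℝ≥0} {B : Set E}
    (hBc : Convex ℝ B) (hBt : B ⊆ (chartAt E x₀).target)
    (hb : ∀ z ∈ (chartAt E x₀).source, chartAt E x₀ z ∈ B → ∀ v : TangentSpace 𝓘(ℝ, E) z,
      ‖v‖ₑ ≤ C * ‖fderiv ℝ (chartAt E x₀ ∘ (chartAt E z).symm) (chartAt E z z) v‖ₑ)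
    {a b : E} (ha : a ∈ B) (hb' : b ∈ B) :
    Manifold.riemannianEDist 𝓘(ℝ, E) ((chartAt E x₀).symm a) ((chartAt E x₀).symm b) ≤
      C * edist a b := by
  set e := chartAt E x₀
  -- The test path is the straight segment of the chart, which convexity keeps in `B`.
  let η := ContinuousAffineMap.lineMap (R := ℝ) a b
  set γ : ℝ → M := e.symm ∘ η with hγ
  have hη : ∀ t ∈ Icc (0 : ℝ) 1, η t ∈ B := by
    intro t ht
    rw [ContinuousAffineMap.coe_lineMap_eq]
    exact hBc.lineMap_mem ha hb' ht
  have η_smooth : ContMDiff 𝓘(ℝ, ℝ) 𝓘(ℝ, E) 1 η := by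
    rw [contMDiff_iff_contDiff]
    exact ContinuousAffineMap.contDiff _
  have hle : Manifold.riemannianEDist 𝓘(ℝ, E) (e.symm a) (e.symm b) ≤
      Manifold.pathELength 𝓘(ℝ, E) γ 0 1 := by
    apply Manifold.riemannianEDist_le_pathELength _ _ _ zero_le_one
    · exact (contMDiffOn_chart_symm (I := 𝓘(ℝ, E)) (n := 1)).comp η_smooth.contMDiffOn
        fun t ht => hBt (hη t ht)
    · simp [hγ, η, ContinuousAffineMap.coe_lineMap_eq]
    · simp [hγ, η, ContinuousAffineMap.coe_lineMap_eq]
  refine hle.trans ?_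
  rw [Manifold.pathELength_eq_lintegral_mfderiv_Ioo]
  have hint : ∫⁻ t in Ioo (0 : ℝ) 1, (C : ℝ≥0∞) * edist a b = C * edist a b := by simp
  rw [← hint]
  refine setLIntegral_mono' measurableSet_Ioo fun t ht => ?_
  have htB : η t ∈ B := hη t ⟨ht.1.le, ht.2.le⟩
  have hs : γ t ∈ e.source := e.map_target (hBt htB)
  have heγ : e (γ t) = η t := e.right_inv (hBt htB)
  have hγd : MDifferentiableAt 𝓘(ℝ, ℝ) 𝓘(ℝ, E) γ t :=
    (((contMDiffOn_chart_symm (I := 𝓘(ℝ, E)) (n := 1)).contMDiffAt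
      (e.open_target.mem_nhds (hBt htB))).mdifferentiableAt one_ne_zero).comp t
      (η_smooth.mdifferentiableAt one_ne_zero)
  have hed : MDifferentiableAt 𝓘(ℝ, E) 𝓘(ℝ, E) e (γ t) :=
    mdifferentiableAt_atlas (chart_mem_atlas E x₀) hs
  have hcomp := mfderiv_comp t hed hγd
  have heq : e ∘ γ =ᶠ[𝓝 t] η := by
    filter_upwards [Ioo_mem_nhds ht.1 ht.2] with s hs
    exact e.right_inv (hBt (hη s ⟨hs.1.le, hs.2.le⟩))
  rw [heq.mfderiv_eq, mfderiv_chartAt_eq_fderiv hs] at hcomp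
  have h1 : fderiv ℝ (e ∘ (chartAt E (γ t)).symm) (chartAt E (γ t) (γ t))
      (mfderiv 𝓘(ℝ, ℝ) 𝓘(ℝ, E) γ t 1) = b - a := by
    have h2 : (mfderiv 𝓘(ℝ, ℝ) 𝓘(ℝ, E) η t : ℝ →L[ℝ] E) 1 = b - a := by
      have h4 : fderiv ℝ η t 1 = b - a := by
        refine fderiv_apply_one_eq_deriv.trans ?_
        simp only [η, ContinuousAffineMap.coe_lineMap_eq]
        exact AffineMap.hasDerivAt_lineMap.deriv
      have h5 : mfderiv 𝓘(ℝ, ℝ) 𝓘(ℝ, E) η t = fderiv ℝ η t := mfderiv_eq_fderiv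
      exact (congrArg (fun T : ℝ →L[ℝ] E => T 1) h5).trans h4
    rw [← h2]
    exact (congrArg (fun T : ℝ →L[ℝ] E => T 1) hcomp).symm
  have h3 := hb (γ t) hs (by rw [heγ]; exact htB) (mfderiv 𝓘(ℝ, ℝ) 𝓘(ℝ, E) γ t 1)
  rw [h1] at h3
  rwa [edist_comm, edist_eq_enorm_sub]

-- The image path in the chart is at least as long as the distance between its ends, and its speed
-- is at most `C` times the speed of `γ`.
omit [∀ z : M, ENormSMulClass ℝ (TangentSpace 𝓘(ℝ, E) z)] in
theorem enorm_chartAt_sub_le_pathELength {x₀ : M} {C : ℝ≥0} {γ : ℝ → M}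
    (hγ : ContMDiff 𝓘(ℝ, ℝ) 𝓘(ℝ, E) 1 γ) {t₁ : ℝ} (ht₁ : 0 ≤ t₁)
    (hs : ∀ t ∈ Icc 0 t₁, γ t ∈ (chartAt E x₀).source)
    (hb : ∀ t ∈ Icc 0 t₁, ∀ v : TangentSpace 𝓘(ℝ, E) (γ t),
      ‖fderiv ℝ (chartAt E x₀ ∘ (chartAt E (γ t)).symm) (chartAt E (γ t) (γ t)) v‖ₑ ≤ C * ‖v‖ₑ) :
    ‖chartAt E x₀ (γ t₁) - chartAt E x₀ (γ 0)‖ₑ ≤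
      C * Manifold.pathELength 𝓘(ℝ, E) γ 0 t₁ := by
  set e := chartAt E x₀
  have hC : ContMDiffOn 𝓘(ℝ, ℝ) 𝓘(ℝ, E) 1 (e ∘ γ) (Icc 0 t₁) :=
    (contMDiffOn_chart (I := 𝓘(ℝ, E)) (n := 1) (x := x₀)).comp hγ.contMDiffOn hs
  have h1 : ‖(e ∘ γ) t₁ - (e ∘ γ) 0‖ₑ ≤ ∫⁻ t in Icc 0 t₁, ‖derivWithin (e ∘ γ) (Icc 0 t₁) t‖ₑ :=
    enorm_sub_le_lintegral_derivWithin_Icc_of_contDiffOn_Icc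
      (by rwa [← contMDiffOn_iff_contDiffOn]) ht₁
  refine h1.trans ?_
  rw [Manifold.pathELength_eq_lintegral_mfderiv_Ioo, ← restrict_Ioo_eq_restrict_Icc,
    ← lintegral_const_mul' _ _ ENNReal.coe_ne_top]
  refine setLIntegral_mono' measurableSet_Ioo fun t ht => ?_
  have htI : t ∈ Icc 0 t₁ := ⟨ht.1.le, ht.2.le⟩
  have hed : MDifferentiableAt 𝓘(ℝ, E) 𝓘(ℝ, E) e (γ t) :=
    mdifferentiableAt_atlas (chart_mem_atlas E x₀) (hs t htI)
  have hγd : MDifferentiableAt 𝓘(ℝ, ℝ) 𝓘(ℝ, E) γ t := hγ.mdifferentiableAt one_ne_zero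
  have hcomp := mfderiv_comp t hed hγd
  rw [mfderiv_chartAt_eq_fderiv (hs t htI)] at hcomp
  have h2 : derivWithin (e ∘ γ) (Icc 0 t₁) t =
      fderiv ℝ (e ∘ (chartAt E (γ t)).symm) (chartAt E (γ t) (γ t))
        (mfderiv 𝓘(ℝ, ℝ) 𝓘(ℝ, E) γ t 1) := by
    rw [derivWithin_of_mem_nhds (Icc_mem_nhds ht.1 ht.2), ← fderiv_apply_one_eq_deriv]
    have h3 : mfderiv 𝓘(ℝ, ℝ) 𝓘(ℝ, E) (e ∘ γ) t = fderiv ℝ (e ∘ γ) t := mfderiv_eq_fderiv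
    rw [h3] at hcomp
    exact congrArg (fun T : ℝ →L[ℝ] E => T 1) hcomp
  rw [h2]
  exact hb t htI _

/-- If the tangent norms bound the norm in a chart, then points at small Riemannian distance are close
in the chart. -/
theorem edist_chartAt_le_riemannianEDist [ProperSpace E] [T2Space M] {x₀ : M} {C : ℝ≥0} (hC : 0 < C)
    {c : E} {R : ℝ} (hR : 0 < R)
    (hBt : Metric.closedBall c (2 * R) ⊆ (chartAt E x₀).target)
    (hb : ∀ z ∈ (chartAt E x₀).source, chartAt E x₀ z ∈ Metric.closedBall c (2 * R) →
      ∀ v : TangentSpace 𝓘(ℝ, E) z,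
        ‖fderiv ℝ (chartAt E x₀ ∘ (chartAt E z).symm) (chartAt E z z) v‖ₑ ≤ C * ‖v‖ₑ)
    {x y : M} (hx : x ∈ (chartAt E x₀).source) (hxB : chartAt E x₀ x ∈ Metric.ball c R)
    (hxy : C * Manifold.riemannianEDist 𝓘(ℝ, E) x y < ENNReal.ofReal R) :
    y ∈ (chartAt E x₀).source ∧
      edist (chartAt E x₀ x) (chartAt E x₀ y) ≤ C * Manifold.riemannianEDist 𝓘(ℝ, E) x y := by
  set e := chartAt E x₀ with he
  have hC0 : (C : ℝ≥0∞) ≠ 0 := by exact_mod_cast hC.ne'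
  set u : Set M := e.symm '' Metric.closedBall c (2 * R) with hu
  set w : Set M := e.symm '' Metric.ball c (2 * R) with hw
  have u_closed : IsClosed u :=
    ((isCompact_closedBall c (2 * R)).image_of_continuousOn
      (e.symm.continuousOn.mono hBt)).isClosed
  have w_open : IsOpen w :=
    e.symm.isOpen_image_of_subset_source Metric.isOpen_ball (Metric.ball_subset_closedBall.trans hBt)
  have hu' : ∀ z ∈ u, z ∈ e.source ∧ e z ∈ Metric.closedBall c (2 * R) := by
    rintro _ ⟨a, ha, rfl⟩
    exact ⟨e.map_target (hBt ha), by rwa [e.right_inv (hBt ha)]⟩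
  have key : ∀ r : ℝ≥0∞, Manifold.riemannianEDist 𝓘(ℝ, E) x y < r → C * r ≤ ENNReal.ofReal R →
      y ∈ e.source ∧ edist (e x) (e y) ≤ C * r := by
    intro r hr hrR
    obtain ⟨γ, hγx, hγy, γ_smooth, hγ, -⟩ :=
      Manifold.exists_lt_locally_constant_of_riemannianEDist_lt hr zero_lt_one
    -- Continuity argument: as long as the path has stayed in the compact set `u`, its chart image
    -- is within `R` of `e x`, hence in the open ball of radius `2 * R`. So the path cannot leave
    -- `u`.
    have hlt : ∀ t₁ ∈ Icc (0 : ℝ) 1, Icc 0 t₁ ⊆ γ ⁻¹' u → ‖e (γ t₁) - e x‖ₑ < C * r := by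
      intro t₁ ht₁ hsub
      have h1 := enorm_chartAt_sub_le_pathELength (x₀ := x₀) (C := C) γ_smooth ht₁.1
        (fun t ht => (hu' _ (hsub ht)).1)
        (fun t ht => hb _ (hu' _ (hsub ht)).1 (hu' _ (hsub ht)).2)
      rw [hγx] at h1
      refine h1.trans_lt ?_
      refine (ENNReal.mul_lt_mul_iff_right hC0 ENNReal.coe_ne_top).2
        ((Manifold.pathELength_mono le_rfl ht₁.2).trans_lt hγ)
    have hxu : x ∈ u := ⟨e x, Metric.ball_subset_closedBall
      (Metric.ball_subset_ball (by linarith) hxB), e.left_inv hx⟩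
    have A_closed : IsClosed (γ ⁻¹' u ∩ Icc 0 1) :=
      (u_closed.preimage γ_smooth.continuous).inter isClosed_Icc
    have hsub : Icc (0 : ℝ) 1 ⊆ γ ⁻¹' u := by
      refine A_closed.Icc_subset_of_forall_mem_nhdsGT_of_Icc_subset (by simpa [hγx] using hxu) ?_
      rintro t₁ ⟨ht₁0, ht₁1⟩ t₁_mem
      have h1 := hlt t₁ ⟨ht₁0, ht₁1.le⟩ t₁_mem
      have h2 := hu' _ (t₁_mem ⟨ht₁0, le_rfl⟩)
      suffices hmem : γ t₁ ∈ w from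
        γ_smooth.continuous.continuousWithinAt <|
          mem_of_superset (w_open.mem_nhds hmem) (image_mono Metric.ball_subset_closedBall)
      refine ⟨e (γ t₁), ?_, e.left_inv h2.1⟩
      have h3 : ‖e (γ t₁) - e x‖ < R := by
        have := h1.trans_le hrR
        rw [← ofReal_norm, ENNReal.ofReal_lt_ofReal_iff hR] at this
        exact this
      rw [Metric.mem_ball, dist_eq_norm] at hxB ⊢
      calc ‖e (γ t₁) - c‖ ≤ ‖e (γ t₁) - e x‖ + ‖e x - c‖ := norm_sub_le_norm_sub_add_norm_sub _ _ _
        _ < 2 * R := by linarith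
    have h1 := hlt 1 ⟨zero_le_one, le_rfl⟩ hsub
    rw [hγy] at h1
    refine ⟨?_, ?_⟩
    · have := (hu' _ (hsub (⟨zero_le_one, le_rfl⟩ : (1 : ℝ) ∈ Icc (0 : ℝ) 1))).1
      rwa [hγy] at this
    · rw [edist_comm, edist_eq_enorm_sub]
      exact h1.le
  have hd : Manifold.riemannianEDist 𝓘(ℝ, E) x y < ENNReal.ofReal R / C := by
    rwa [ENNReal.lt_div_iff_mul_lt (Or.inl hC0) (Or.inl ENNReal.coe_ne_top), mul_comm]
  refine ⟨(key _ hd (by rw [ENNReal.mul_div_cancel hC0 ENNReal.coe_ne_top])).1, ?_⟩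
  rw [mul_comm, ← ENNReal.div_le_iff_le_mul (Or.inl hC0) (Or.inl ENNReal.coe_ne_top)]
  -- `key` needs a number strictly above the distance, so the sharp bound comes by letting `r'`
  -- decrease to it.
  refine le_of_forall_gt fun r hr => ?_
  obtain ⟨r', hr', hr'r⟩ := exists_between (lt_min hr hd)
  have hm : C * r' ≤ ENNReal.ofReal R := by
    rw [mul_comm, ← ENNReal.le_div_iff_mul_le (Or.inl hC0) (Or.inl ENNReal.coe_ne_top)]
    exact (hr'r.trans_le (min_le_right _ _)).le
  have h1 := (key r' hr' hm).2
  rw [mul_comm, ← ENNReal.div_le_iff_le_mul (Or.inl hC0) (Or.inl ENNReal.coe_ne_top)] at h1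
  exact h1.trans_lt (hr'r.trans_le (min_le_left _ _))

end ChartDistance

/-! ### Comparison of distances for the Chern form -/

section LineBundle

variable {n : ℕ} {X : Type*} [TopologicalSpace X] [ChartedSpace (ComplexModel n) X]
  {L : X → Type*} [TopologicalSpace (TotalSpace ℂ L)] [∀ x, TopologicalSpace (L x)]
  [∀ x, AddCommGroup (L x)] [∀ x, Module ℂ (L x)] [FiberBundle ℂ L] [VectorBundle ℂ ℂ L]

namespace SmoothHermitianMetric

variable (h : SmoothHermitianMetric n L)

omit [VectorBundle ℂ ℂ L] in
theorem chernMetric_smul_self (x : X) (t : ℝ) (v : ComplexModel n) :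
    h.chernMetric x (t • v) (t • v) = t ^ 2 * h.chernMetric x v v := by
  have := leviForm_smul
    (fun z => h.localWeight x ((chartAt (ComplexModel n) x).symm z)) (chartAt (ComplexModel n) x x) v t
  change 1 / (2 * Real.pi) * leviForm _ _ _ = t ^ 2 * (1 / (2 * Real.pi) * leviForm _ _ _)
  rw [this]
  ring

/-- Near each point, the Riemannian distance of the Chern form is comparable to the distance in a
chart, and the local weight is Lipschitz. -/
theorem exists_chart_comparison [T2Space X] [IsManifold 𝓘(ℂ, ComplexModel n) ω X]
    [ContMDiffVectorBundle ω ℂ L 𝓘(ℂ, ComplexModel n)] (hpos : h.IsPositive) (x₀ : X) :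
    ∃ C R : ℝ, 1 ≤ C ∧ 0 < R ∧ R ≤ 1 ∧
      (∀ a ∈ Metric.closedBall (chartAt (ComplexModel n) x₀ x₀) (2 * R),
        a ∈ (chartAt (ComplexModel n) x₀).target ∧
        (chartAt (ComplexModel n) x₀).symm a ∈ (trivializationAt ℂ L x₀).baseSet) ∧
      (∀ a ∈ Metric.closedBall (chartAt (ComplexModel n) x₀ x₀) (2 * R),
        ∀ b ∈ Metric.closedBall (chartAt (ComplexModel n) x₀ x₀) (2 * R),
          h.rdist ((chartAt (ComplexModel n) x₀).symm a) ((chartAt (ComplexModel n) x₀).symm b) ≤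
            ENNReal.ofReal (C * dist a b) ∧
          |h.localWeight x₀ ((chartAt (ComplexModel n) x₀).symm a) -
            h.localWeight x₀ ((chartAt (ComplexModel n) x₀).symm b)| ≤ C * dist a b) ∧
      ∀ x ∈ (chartAt (ComplexModel n) x₀).source,
        chartAt (ComplexModel n) x₀ x ∈ Metric.ball (chartAt (ComplexModel n) x₀ x₀) R →
        ∀ r : ℝ, 0 < r → C * r ≤ R → ∀ y ∈ h.rball x r, y ∈ (chartAt (ComplexModel n) x₀).source ∧
          dist (chartAt (ComplexModel n) x₀ y) (chartAt (ComplexModel n) x₀ x) ≤ C * r := by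
  have : IsManifold 𝓘(ℝ, ComplexModel n) ω X := isManifold_real_of_complex
  have : IsManifold 𝓘(ℝ, ComplexModel n) 1 X := IsManifold.of_le (n := ω) le_top
  let : ∀ z : X, ENorm (TangentSpace 𝓘(ℝ, ComplexModel n) z) :=
    fun z => ⟨fun v => ENNReal.ofReal (Real.sqrt (h.chernMetric z v v))⟩
  have hnorm : ∀ (z : X) (v : TangentSpace 𝓘(ℝ, ComplexModel n) z),
    ‖v‖ₑ = ENNReal.ofReal (Real.sqrt (h.chernMetric z v v)) := fun _ _ => rfl
  let : ∀ z : X, ENormSMulClass ℝ (TangentSpace 𝓘(ℝ, ComplexModel n) z) := by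
    refine fun z => ⟨fun t v => ?_⟩
    rw [hnorm, hnorm]
    erw [h.chernMetric_smul_self z t v]
    rw [Real.sqrt_mul (sq_nonneg t), Real.sqrt_sq_eq_abs, ENNReal.ofReal_mul (abs_nonneg _),
      ← Real.enorm_eq_ofReal_abs]
  set e := chartAt (ComplexModel n) x₀ with he
  have hxs : x₀ ∈ e.source := mem_chart_source (ComplexModel n) x₀
  have hxb : x₀ ∈ (trivializationAt ℂ L x₀).baseSet := FiberBundle.mem_baseSet_trivializationAt' x₀
  obtain ⟨K, hK, hb⟩ := h.exists_eventually_chernMetric_bounds hpos x₀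
  obtain ⟨K', t, ht, hlip⟩ := ((h.contDiffAt_localWeight_comp_symm hxb hxs).of_le
    (ENat.LEInfty.out : (1 : ℕ∞ω) ≤ (∞ : ℕ∞ω))).exists_lipschitzOnWith
  have hsymm : ContinuousAt e.symm (e x₀) := e.symm.continuousAt (by simpa using e.map_source hxs)
  have hleft : e.symm (e x₀) = x₀ := e.left_inv hxs
  have hev : ∀ᶠ a in 𝓝 (e x₀), a ∈ e.target ∧
      e.symm a ∈ (trivializationAt ℂ L x₀).baseSet ∧ a ∈ t ∧
      ∀ v : ComplexModel n,
      ‖fderiv ℝ (e ∘ (chartAt (ComplexModel n) (e.symm a)).symm)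
          (chartAt (ComplexModel n) (e.symm a) (e.symm a)) v‖ₑ ≤
        K * ENNReal.ofReal (Real.sqrt (h.chernMetric (e.symm a) v v)) ∧
      ENNReal.ofReal (Real.sqrt (h.chernMetric (e.symm a) v v)) ≤
        K * ‖fderiv ℝ (e ∘ (chartAt (ComplexModel n) (e.symm a)).symm)
          (chartAt (ComplexModel n) (e.symm a) (e.symm a)) v‖ₑ := by
    rw [show 𝓝 x₀ = 𝓝 (e.symm (e x₀)) by rw [hleft]] at hb
    have hbs : (trivializationAt ℂ L x₀).baseSet ∈ 𝓝 (e.symm (e x₀)) := by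
      rw [hleft]
      exact (trivializationAt ℂ L x₀).open_baseSet.mem_nhds hxb
    filter_upwards [e.open_target.mem_nhds (e.map_source hxs), hsymm hbs, ht,
      hsymm.eventually hb] with a h1 h2 h3 h4
    exact ⟨h1, h2, h3, h4⟩
  obtain ⟨ε, hε, hball⟩ := Metric.eventually_nhds_iff.1 hev
  -- The third of `ε` puts the closed ball of radius `2 * R` inside the ball of radius `ε`; the
  -- bound `1` is for later powers of `R`.
  set R : ℝ := min (ε / 3) 1 with hR
  have hR0 : 0 < R := lt_min (by positivity) one_pos
  have hball' : ∀ a ∈ Metric.closedBall (e x₀) (2 * R), dist a (e x₀) < ε := by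
    intro a ha
    have : R ≤ ε / 3 := min_le_left _ _
    rw [Metric.mem_closedBall] at ha
    linarith
  -- `K` compares the metrics, `K'` is the Lipschitz constant of the weight, and the `1` ensures `1
  -- ≤ C`.
  refine ⟨K + K' + 1, R, ?_, hR0, min_le_right _ _, ?_, ?_, ?_⟩
  · have := K.coe_nonneg; have := K'.coe_nonneg
    simp
    positivity
  · intro a ha
    exact ⟨(hball (hball' a ha)).1, (hball (hball' a ha)).2.1⟩
  · intro a ha b hb'
    constructor
    · have h1 := riemannianEDist_chartAt_symm_le (M := X) (x₀ := x₀) (C := K)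
        (convex_closedBall (e x₀) (2 * R)) (fun a ha => (hball (hball' a ha)).1) (by
          intro z hz hzB v
          have h2 := ((hball (hball' _ hzB)).2.2.2 v).2
          erw [e.left_inv hz] at h2
          exact h2) ha hb'
      refine h1.trans ?_
      rw [edist_dist, ← ENNReal.ofReal_coe_nnreal, ← ENNReal.ofReal_mul K.coe_nonneg]
      refine ENNReal.ofReal_le_ofReal ?_
      gcongr
      have := K'.coe_nonneg
      linarith
    · have h1 := hlip.dist_le_mul a (hball (hball' a ha)).2.2.1 b (hball (hball' b hb')).2.2.1
      rw [Real.dist_eq] at h1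
      refine h1.trans ?_
      gcongr
      have := K.coe_nonneg
      linarith
  · intro x hx hxB r hr hrR y hy
    have hKr : K * h.rdist x y ≤ ENNReal.ofReal (K * r) := by
      rw [ENNReal.ofReal_mul K.coe_nonneg, ENNReal.ofReal_coe_nnreal]
      gcongr
      exact hy.le
    have hKr' : K * h.rdist x y < ENNReal.ofReal R := by
      refine hKr.trans_lt ((ENNReal.ofReal_lt_ofReal_iff hR0).2 (lt_of_lt_of_le ?_ hrR))
      have := K'.coe_nonneg
      gcongr
      linarith
    have h1 := edist_chartAt_le_riemannianEDist (M := X) (x₀ := x₀) hK hR0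
      (fun a ha => (hball (hball' a ha)).1) (by
        intro z hz hzB v
        have h2 := ((hball (hball' _ hzB)).2.2.2 v).1
        erw [e.left_inv hz] at h2
        exact h2) hx hxB hKr'
    refine ⟨h1.1, ?_⟩
    have h2 := h1.2.trans hKr
    rw [edist_comm, edist_dist, ENNReal.ofReal_le_ofReal_iff (by positivity)] at h2
    refine h2.trans ?_
    have := K'.coe_nonneg
    gcongr
    linarith

end SmoothHermitianMetric

end LineBundle

/-! ### Plurisubharmonicity of log-moduli -/

section LogModulus

theorem circleIntegralEReal_eq_of_ae {w : ℝ → EReal} {v : ℝ → ℝ}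
    (hv : IntegrableOn v (Ioc 0 (2 * Real.pi)))
    (hw : ∀ᵐ θ ∂(volume.restrict (Ioc 0 (2 * Real.pi))), w θ = (v θ : EReal)) :
    circleIntegralEReal w = ((∫ θ in Ioc 0 (2 * Real.pi), v θ : ℝ) : EReal) := by
  have h1 : ∫⁻ θ in Ioc 0 (2 * Real.pi), (w θ).toENNReal =
      ∫⁻ θ in Ioc 0 (2 * Real.pi), ENNReal.ofReal (v θ) :=
    lintegral_congr_ae (hw.mono fun θ hθ => by simp only [hθ, EReal.real_coe_toENNReal])
  have h2 : ∫⁻ θ in Ioc 0 (2 * Real.pi), (-w θ).toENNReal =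
      ∫⁻ θ in Ioc 0 (2 * Real.pi), ENNReal.ofReal (-v θ) :=
    lintegral_congr_ae (hw.mono fun θ hθ => by
      simp only [hθ, ← EReal.coe_neg, EReal.real_coe_toENNReal])
  have f1 : ∫⁻ θ in Ioc 0 (2 * Real.pi), ENNReal.ofReal (v θ) ≠ ⊤ := hv.lintegral_lt_top.ne
  have f2 : ∫⁻ θ in Ioc 0 (2 * Real.pi), ENNReal.ofReal (-v θ) ≠ ⊤ := hv.neg.lintegral_lt_top.ne
  rw [circleIntegralEReal, h1, h2, integral_eq_lintegral_pos_part_sub_lintegral_neg_part hv,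
    EReal.coe_sub, EReal.coe_ennreal_toReal f1, EReal.coe_ennreal_toReal f2]

/-- Jensen's formula: the difference is a sum over the zeros `u` in the closed disc of the
multiplicity times `log (1 / |u|)`, which is nonnegative. -/
theorem log_norm_le_circleAverage {F : ℂ → ℂ} (hF : AnalyticOnNhd ℂ F (Metric.closedBall 0 1))
    (h0 : F 0 ≠ 0) : Real.log ‖F 0‖ ≤ Real.circleAverage (fun z => Real.log ‖F z‖) 0 1 := by
  have hF' : AnalyticOnNhd ℂ F (Metric.closedBall 0 |1|) := by simpa using hF
  rw [hF'.circleAverage_log_norm one_ne_zero h0, le_add_iff_nonneg_left]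
  refine finsum_nonneg fun u => ?_
  by_cases hu : u ∈ Metric.closedBall (0 : ℂ) |1|
  · refine mul_nonneg ?_ ?_
    · exact_mod_cast (MeromorphicOn.AnalyticOnNhd.divisor_nonneg hF') u
    · simp only [abs_one, mem_closedBall_zero_iff] at hu
      rcases eq_or_ne u 0 with rfl | hu0
      · simp
      · rw [zero_sub, norm_neg, one_mul]
        exact Real.log_nonneg ((one_le_inv₀ (norm_pos_iff.2 hu0)).2 hu)
  · rw [Function.locallyFinsuppWithin.apply_eq_zero_of_notMem _ hu]
    simp

/-- By the identity theorem the zeros in the disc are isolated, so they are negligible on the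
circle. This matters because `ENNReal.log 0` is `⊥` while `Real.log 0` is `0`: the two logarithms
agree only almost everywhere there. -/
theorem ae_circle_ne_zero {F : ℂ → ℂ} (hF : AnalyticOnNhd ℂ F (Metric.closedBall 0 1))
    (h0 : F 0 ≠ 0) :
    ∀ᵐ θ : ℝ ∂(volume.restrict (Ioc 0 (2 * Real.pi))), F (Complex.exp (θ * Complex.I)) ≠ 0 := by
  have h1 : ∀ᶠ z in codiscreteWithin (Metric.closedBall (0 : ℂ) 1), F z ≠ 0 := by
    rcases hF.eqOn_zero_or_eventually_ne_zero_of_preconnected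
      (convex_closedBall (0 : ℂ) 1).isPreconnected with h | h
    · exact absurd (h (by simp)) h0
    · exact h
  have h2 : ∀ᶠ z in codiscreteWithin (Metric.sphere (0 : ℂ) |1|), F z ≠ 0 :=
    codiscreteWithin_mono (by simpa using Metric.sphere_subset_closedBall) h1
  have h3 := circleMap_preimage_codiscrete (c := 0) (R := 1) one_ne_zero h2
  have h4 : ∀ᶠ θ in codiscreteWithin (Ioc 0 (2 * Real.pi)), F (circleMap 0 1 θ) ≠ 0 :=
    codiscreteWithin_mono (subset_univ _) h3
  have h5 := ae_restrict_le_codiscreteWithin (μ := (volume : Measure ℝ)) measurableSet_Ioc h4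
  filter_upwards [h5] with θ hθ
  simpa [circleMap] using hθ

theorem log_modulus_le_circleIntegralEReal {F : ℂ → ℂ}
    (hF : AnalyticOnNhd ℂ F (Metric.closedBall 0 1)) {k q : ℝ} (hk : 0 < k) (hq : 0 < q) :
    ((2 * Real.pi : ℝ) : EReal) * ENNReal.log (ENNReal.ofReal (k * ‖F 0‖ ^ q)) ≤
      circleIntegralEReal
        (fun θ => ENNReal.log (ENNReal.ofReal (k * ‖F (Complex.exp (θ * Complex.I))‖ ^ q))) := by
  have hpi : 0 < 2 * Real.pi := by positivity
  by_cases h0 : F 0 = 0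
  · rw [h0, norm_zero, Real.zero_rpow hq.ne', mul_zero, ENNReal.ofReal_zero, ENNReal.log_zero,
      EReal.coe_mul_bot_of_pos hpi]
    exact bot_le
  have hlog : ∀ z : ℂ, z ≠ 0 → ENNReal.log (ENNReal.ofReal (k * ‖z‖ ^ q)) =
      ((Real.log k + q * Real.log ‖z‖ : ℝ) : EReal) := by
    intro z hz
    have hz' : 0 < ‖z‖ := norm_pos_iff.2 hz
    rw [ENNReal.log_ofReal_of_pos (by positivity), Real.log_mul hk.ne' (by positivity),
      Real.log_rpow hz']
  set l : ℝ → ℝ := fun θ => Real.log ‖F (circleMap 0 1 θ)‖ with hl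
  have hsph : Metric.sphere (0 : ℂ) |1| ⊆ Metric.closedBall 0 1 := by
    simpa using Metric.sphere_subset_closedBall
  have hint : IntegrableOn l (Ioc 0 (2 * Real.pi)) := by
    have := MeromorphicOn.circleIntegrable_log_norm (f := F) (c := 0) (R := 1)
      fun z hz => (hF z (hsph hz)).meromorphicAt
    rwa [CircleIntegrable, intervalIntegrable_iff_integrableOn_Ioc_of_le hpi.le] at this
  have hconst : Integrable (fun _ : ℝ => Real.log k) (volume.restrict (Ioc 0 (2 * Real.pi))) :=
    integrable_const _
  have hint2 : IntegrableOn (fun θ => Real.log k + q * l θ) (Ioc 0 (2 * Real.pi)) :=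
    hconst.add (hint.const_mul q)
  rw [hlog _ h0, circleIntegralEReal_eq_of_ae hint2 (by
    filter_upwards [ae_circle_ne_zero hF h0] with θ hθ
    rw [hlog _ hθ]
    simp [hl, circleMap]), ← EReal.coe_mul, EReal.coe_le_coe_iff,
    integral_add hconst (hint.const_mul q), integral_const_mul]
  have hJ := log_norm_le_circleAverage hF h0
  rw [Real.circleAverage, intervalIntegral.integral_of_le hpi.le, smul_eq_mul,
    le_inv_mul_iff₀ hpi] at hJ
  have hc : ∫ _ in Ioc 0 (2 * Real.pi), Real.log k = 2 * Real.pi * Real.log k := by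
    simp [hpi.le]
  rw [hc, mul_add]
  nlinarith

/-- `q log |F| + log k` is plurisubharmonic when `F` is holomorphic. -/
theorem plurisubharmonicOn_log_modulus {E : Type*} [NormedAddCommGroup E] [NormedSpace ℂ E]
    {F : E → ℂ} {Ω : Set E} (hΩ : IsOpen Ω) (hF : DifferentiableOn ℂ F Ω) {k q : ℝ}
    (hk : 0 < k) (hq : 0 < q) :
    PlurisubharmonicOn (fun z => ENNReal.log (ENNReal.ofReal (k * ‖F z‖ ^ q))) Ω := by
  refine ⟨?_, fun z _ => (ENNReal.log_lt_top_iff.2 ENNReal.ofReal_lt_top).ne, fun a v hav => ?_⟩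
  · refine ContinuousOn.upperSemicontinuousOn ?_
    refine ENNReal.continuous_log.comp_continuousOn (ENNReal.continuous_ofReal.comp_continuousOn ?_)
    exact continuousOn_const.mul (hF.continuousOn.norm.rpow_const fun _ _ => Or.inr hq.le)
  · set l : ℂ → E := fun ζ => a + ζ • v
    have hl : Differentiable ℂ l := by fun_prop
    have ho : IsOpen (l ⁻¹' Ω) := hΩ.preimage hl.continuous
    have hd : DifferentiableOn ℂ (F ∘ l) (l ⁻¹' Ω) :=
      hF.comp hl.differentiableOn (mapsTo_preimage _ _)
    have hA : AnalyticOnNhd ℂ (F ∘ l) (Metric.closedBall 0 1) :=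
      (hd.analyticOnNhd ho).mono fun ζ hζ => hav ζ (by simpa using hζ)
    have := log_modulus_le_circleIntegralEReal hA hk hq
    simpa [l] using this

theorem PlurisubharmonicOn.congr {E : Type*} [NormedAddCommGroup E] [NormedSpace ℂ E]
    {u w : E → EReal} {Ω : Set E} (hu : PlurisubharmonicOn u Ω) (h : EqOn w u Ω) :
    PlurisubharmonicOn w Ω := by
  obtain ⟨h1, h2, h3⟩ := hu
  refine ⟨fun z hz b hb => ?_, fun z hz => by rw [h hz]; exact h2 z hz,
    fun a v hav => ?_⟩
  · replace hb : w z < b := hb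
    rw [h hz] at hb
    filter_upwards [h1 z hz b hb, self_mem_nhdsWithin] with y hy hyΩ
    rwa [h hyΩ]
  have ha : a ∈ Ω := by simpa using hav 0 (by simp)
  rw [h ha]
  refine (h3 a v hav).trans_eq ?_
  congr 1
  ext1 θ
  exact (h (hav _ (by simp [Complex.norm_exp_ofReal_mul_I]))).symm

end LogModulus

/-! ### Sections of powers and their ω₀-psh functions -/

section LineBundle

variable {n : ℕ} {X : Type*} [TopologicalSpace X] [ChartedSpace (ComplexModel n) X]
  {L : X → Type*} [TopologicalSpace (TotalSpace ℂ L)] [∀ x, TopologicalSpace (L x)]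
  [∀ x, AddCommGroup (L x)] [∀ x, Module ℂ (L x)] [FiberBundle ℂ L] [VectorBundle ℂ ℂ L]

theorem linearMapAt_eq_frameRatio_mul {x₁ x₀ y : X} (hy : y ∈ (trivializationAt ℂ L x₀).baseSet)
    (v : L y) : (trivializationAt ℂ L x₁).linearMapAt ℂ y v =
      frameRatio L x₀ x₁ y * (trivializationAt ℂ L x₀).linearMapAt ℂ y v := by
  conv_lhs => rw [← linearMapAt_smul_localFrame hy v]
  rw [map_smul, smul_eq_mul, mul_comm, frameRatio]

theorem powerCoord_eq_frameRatio_pow_mul {x₁ x₀ y : X}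
    (hy : y ∈ (trivializationAt ℂ L x₀).baseSet) (p : ℕ) (v : ⨂[ℂ]^p (L y)) :
    powerCoord x₁ y p v = frameRatio L x₀ x₁ y ^ p * powerCoord x₀ y p v := by
  have h : powerCoord (L := L) x₁ y p = frameRatio L x₀ x₁ y ^ p • powerCoord x₀ y p := by
    refine PiTensorProduct.ext (MultilinearMap.ext fun w => ?_)
    simp [powerCoord, linearMapAt_eq_frameRatio_mul (x₁ := x₁) hy, Finset.prod_mul_distrib]
  rw [h]
  rfl

namespace SmoothHermitianMetric

variable (h : SmoothHermitianMetric n L)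

/-- The length is defined with the frame at the point itself; a single frame near `x₀` exhibits it
as the modulus of a coordinate, holomorphic for a holomorphic section, times a smooth factor. -/
theorem powerLen_eq {x₀ y : X} (hy : y ∈ (trivializationAt ℂ L x₀).baseSet) (p : ℕ)
    (v : ⨂[ℂ]^p (L y)) :
    h.powerLen p y v = ‖powerCoord x₀ y p v‖ * Real.exp (-(p * h.localWeight x₀ y)) := by
  have hyb : y ∈ (trivializationAt ℂ L y).baseSet := FiberBundle.mem_baseSet_trivializationAt' y
  have h1 : Real.exp (-(p * h.localWeight x₀ y)) = h.len y (localFrame L x₀ y) ^ p := by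
    rw [localWeight, mul_neg, neg_neg, Real.exp_nat_mul, Real.exp_log (h.len_localFrame_pos hy)]
  rw [h1, powerLen, powerCoord_eq_frameRatio_pow_mul (x₁ := y) hy,
    localFrame_eq_smul (x₁ := x₀) hyb, h.len_smul, norm_mul, norm_pow, mul_pow]
  ring

theorem powerLen_nonneg (p : ℕ) (y : X) (v : ⨂[ℂ]^p (L y)) : 0 ≤ h.powerLen p y v := by
  rw [h.powerLen_eq (FiberBundle.mem_baseSet_trivializationAt' y)]
  positivity

/-- The coordinate of a holomorphic section of `L^p` in the chart and frame at `x₀`. -/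
theorem differentiableOn_powerCoord_comp_symm [IsManifold 𝓘(ℂ, ComplexModel n) ω X] {p : ℕ}
    {s : ∀ x, ⨂[ℂ]^p (L x)} (hs : IsHolomorphicSection n p s) (x₀ : X) :
    DifferentiableOn ℂ (fun z => powerCoord x₀ ((chartAt (ComplexModel n) x₀).symm z) p
        (s ((chartAt (ComplexModel n) x₀).symm z)))
      ((chartAt (ComplexModel n) x₀).target ∩
        (chartAt (ComplexModel n) x₀).symm ⁻¹' (trivializationAt ℂ L x₀).baseSet) := by
  have h1 : MDifferentiableOn 𝓘(ℂ, ComplexModel n) 𝓘(ℂ, ComplexModel n)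
      (chartAt (ComplexModel n) x₀).symm (chartAt (ComplexModel n) x₀).target :=
    (contMDiffOn_chart_symm (I := 𝓘(ℂ, ComplexModel n)) (n := ω)).mdifferentiableOn (by simp)
  exact ((hs x₀).comp (h1.mono inter_subset_left) fun z hz => hz.2).differentiableOn

/-- In a frame the `p`-th root of the length is `|F| ^ (1 / p) * e ^ (-u)`, so adding the local
potential `u` leaves the logarithm of `k * |F| ^ (1 / p)`. Nonvanishing at `x` only excludes the
function `-∞`. -/
theorem isOmegaPSH_log_powerLen [IsManifold 𝓘(ℂ, ComplexModel n) ω X] {p : ℕ} (hp : 1 ≤ p)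
    {s : ∀ x, ⨂[ℂ]^p (L x)} (hs : IsHolomorphicSection n p s) {x : X}
    (hx : 0 < h.powerLen p x (s x)) {k : ℝ} (hk : 0 < k) :
    h.IsOmegaPSH fun y =>
      ENNReal.log (ENNReal.ofReal (k * h.powerLen p y (s y) ^ (1 / (p : ℝ)))) := by
  have hp0 : (0 : ℝ) < p := by exact_mod_cast hp
  refine ⟨⟨x, ?_⟩, fun x₀ => ?_⟩
  · rw [Ne, ENNReal.log_eq_bot_iff, ENNReal.ofReal_eq_zero, not_le]
    positivity
  · set e := chartAt (ComplexModel n) x₀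
    have ho : IsOpen (e.target ∩ e.symm ⁻¹' (trivializationAt ℂ L x₀).baseSet) :=
      e.isOpen_inter_preimage_symm (trivializationAt ℂ L x₀).open_baseSet
    refine (plurisubharmonicOn_log_modulus ho (differentiableOn_powerCoord_comp_symm hs x₀) hk
      (one_div_pos.2 hp0)).congr fun z hz => ?_
    simp only
    rw [h.powerLen_eq hz.2, Real.mul_rpow (norm_nonneg _) (Real.exp_pos _).le, ← Real.exp_mul]
    rw [show -(p * h.localWeight x₀ (e.symm z)) * (1 / (p : ℝ)) = -h.localWeight x₀ (e.symm z) by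
      field_simp]
    set u := h.localWeight x₀ (e.symm z)
    have hu : (u : EReal) = ENNReal.log (ENNReal.ofReal (Real.exp u)) := by
      rw [ENNReal.log_ofReal_of_pos (Real.exp_pos u), Real.log_exp]
    rw [hu, ← ENNReal.log_mul_add, ← ENNReal.ofReal_mul' (Real.exp_pos u).le]
    congr 2
    rw [mul_assoc, mul_assoc, ← Real.exp_add, neg_add_cancel, Real.exp_zero, mul_one]

theorem continuous_powerLen [IsManifold 𝓘(ℂ, ComplexModel n) ω X] {p : ℕ}
    {s : ∀ x, ⨂[ℂ]^p (L x)} (hs : IsHolomorphicSection n p s) :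
    Continuous fun y => h.powerLen p y (s y) := by
  refine continuous_iff_continuousAt.2 fun x₀ => ?_
  have hb : (trivializationAt ℂ L x₀).baseSet ∈ 𝓝 x₀ :=
    (trivializationAt ℂ L x₀).open_baseSet.mem_nhds (FiberBundle.mem_baseSet_trivializationAt' x₀)
  have h1 : ContinuousAt (fun y => powerCoord x₀ y p (s y)) x₀ :=
    (hs x₀).continuousOn.continuousAt hb
  have h2 : ContinuousAt (h.localWeight x₀) x₀ :=
    (h.contMDiffAt_localWeight (mem_of_mem_nhds hb)).continuousAt
  have h3 : ContinuousAt
      (fun y => ‖powerCoord x₀ y p (s y)‖ * Real.exp (-(p * h.localWeight x₀ y))) x₀ :=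
    h1.norm.mul (Real.continuous_exp.continuousAt.comp (continuousAt_const.mul h2).neg)
  exact h3.congr (Filter.eventually_of_mem hb fun y hy => (h.powerLen_eq hy p _).symm)

end SmoothHermitianMetric

end LineBundle

/-! ### Elementary inequalities -/

theorem coe_eq_log_ofReal_exp (b : ℝ) : (b : EReal) = ENNReal.log (ENNReal.ofReal (Real.exp b)) := by
  rw [ENNReal.log_ofReal_of_pos (Real.exp_pos b), Real.log_exp]

/-- Dictionary between the extended-real competitor `(1/p) log (a / M)` and real bounds on lengths,
valid also at zeros of the section. -/
theorem log_normalized_root_le_iff {M a b : ℝ} (hM : 0 < M) (ha : 0 ≤ a) {p : ℕ} (hp : 1 ≤ p) :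
    ENNReal.log (ENNReal.ofReal ((M⁻¹) ^ (1 / (p : ℝ)) * a ^ (1 / (p : ℝ)))) ≤ (b : EReal) ↔
      a ≤ M * Real.exp (p * b) := by
  have hp0 : (0 : ℝ) < p := by exact_mod_cast hp
  rw [coe_eq_log_ofReal_exp, ENNReal.log_le_log_iff, ENNReal.ofReal_le_ofReal_iff (Real.exp_pos b).le,
    ← Real.mul_rpow (by positivity) ha, one_div,
    Real.rpow_inv_le_iff_of_pos (by positivity) (Real.exp_pos b).le hp0, ← Real.exp_mul,
    inv_mul_le_iff₀ hM, mul_comm b]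

/-- This fixes the scale of the argument: at radius `R * p ^ (-N)`, an `α`-Hölder oscillation
multiplied by `p` remains bounded. -/
theorem mul_rpow_neg_rpow_le_one {R N α p : ℝ} (hR0 : 0 ≤ R) (hR : R ≤ 1) (hα : 0 < α)
    (hN : 1 ≤ N * α) (hp : 1 ≤ p) : p * (R * p ^ (-N)) ^ α ≤ 1 := by
  have hp0 : 0 < p := by linarith
  rw [Real.mul_rpow hR0 (by positivity), ← Real.rpow_mul hp0.le]
  have h1 : p ^ (-N * α) ≤ p ^ (-1 : ℝ) := Real.rpow_le_rpow_of_exponent_le hp (by linarith)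
  have h2 : R ^ α ≤ 1 := Real.rpow_le_one hR0 hR hα.le
  have h3 : R ^ α * p ^ (-N * α) ≤ 1 * p ^ (-1 : ℝ) := by gcongr
  rw [Real.rpow_neg_one, one_mul] at h3
  calc p * (R ^ α * p ^ (-N * α)) ≤ p * p⁻¹ := by gcongr
    _ = 1 := mul_inv_cancel₀ hp0.ne'

theorem rpow_le_mul_exp_rpow {p N δ : ℝ} (hp : 1 ≤ p) (hN : 0 ≤ N) (hδ : δ < 1) :
    p ^ N ≤ Real.exp (N / (1 - δ) * p ^ (1 - δ)) := by
  have hp0 : 0 < p := by linarith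
  rw [Real.rpow_def_of_pos hp0]
  refine Real.exp_le_exp.2 ?_
  have := Real.log_le_rpow_div hp0.le (sub_pos.2 hδ)
  calc Real.log p * N ≤ p ^ (1 - δ) / (1 - δ) * N := by gcongr
    _ = N / (1 - δ) * p ^ (1 - δ) := by ring

/-! ### Bernstein–Walsh, local lower bounds and the norm -/

section LineBundle

variable {n : ℕ} {X : Type*} [TopologicalSpace X] [ChartedSpace (ComplexModel n) X]
  {L : X → Type*} [TopologicalSpace (TotalSpace ℂ L)] [∀ x, TopologicalSpace (L x)]
  [∀ x, AddCommGroup (L x)] [∀ x, Module ℂ (L x)] [FiberBundle ℂ L] [VectorBundle ℂ ℂ L]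

namespace SmoothHermitianMetric

variable (h : SmoothHermitianMetric n L)

omit [VectorBundle ℂ ℂ L] in
theorem envelope_le {K : Set X} {φ : X → ℝ} {x : X} (hx : x ∈ K) : h.envelope K φ x ≤ φ x :=
  iSup₂_le fun _ hψ => hψ.2 x hx

theorem powerLen_eq_weightedLen_mul (p : ℕ) (φ : X → ℝ) (x : X) (v : ⨂[ℂ]^p (L x)) :
    h.powerLen p x v = h.weightedLen p φ x v * Real.exp (p * φ x) := by
  rw [weightedLen, mul_assoc, ← Real.exp_add, neg_add_cancel, Real.exp_zero, mul_one]

theorem weightedLen_nonneg (p : ℕ) (φ : X → ℝ) (x : X) (v : ⨂[ℂ]^p (L x)) :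
    0 ≤ h.weightedLen p φ x v :=
  mul_nonneg (h.powerLen_nonneg p x v) (Real.exp_pos _).le

section

variable [IsManifold 𝓘(ℂ, ComplexModel n) ω X] {K : Set X} {φ g : X → ℝ} {p : ℕ}
  {s : ∀ x, ⨂[ℂ]^p (L x)} {M : ℝ} {xK : X}

/-- The Bernstein-Walsh inequality. -/
theorem powerLen_le_exp_envelope (hp : 1 ≤ p) (hs : IsHolomorphicSection n p s)
    (hg : ∀ z, h.envelope K φ z = (g z : EReal)) (hM : 0 < M)
    (hxM : h.weightedLen p φ xK (s xK) = M) (hle : ∀ x ∈ K, h.weightedLen p φ x (s x) ≤ M) (z : X) :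
    h.powerLen p z (s z) ≤ M * Real.exp (p * g z) := by
  have hpos : 0 < h.powerLen p xK (s xK) := by
    rw [h.powerLen_eq_weightedLen_mul p φ, hxM]
    positivity
  rw [← log_normalized_root_le_iff hM (h.powerLen_nonneg _ _ _) hp, ← hg z]
  -- The normalized logarithm is a competitor for the envelope; its constant `M ^ (-1 / p)` is
  -- chosen so that it is at most `φ` on `K`.
  refine le_iSup₂_of_le (f := fun (ψ : X → EReal) (_ : ψ ∈ {ψ : X → EReal |
    h.IsOmegaPSH ψ ∧ ∀ x ∈ K, ψ x ≤ (φ x : EReal)}) => ψ z) _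
    ⟨h.isOmegaPSH_log_powerLen hp hs hpos (k := (M⁻¹) ^ (1 / (p : ℝ))) (by positivity),
      fun x hx => ?_⟩ le_rfl
  rw [log_normalized_root_le_iff hM (h.powerLen_nonneg _ _ _) hp,
    h.powerLen_eq_weightedLen_mul p φ]
  gcongr
  exact hle x hx

/-- At `xK` the normalized logarithm equals `φ`, so the supremum over `W` is at least `0`.
Attainment is not needed: some point of `W` exceeds `-log 2 / p`, which costs a factor `2` after
taking `p`-th powers. -/
theorem exists_half_le_weightedLen {W : Set X} (hp : 1 ≤ p) (hs : IsHolomorphicSection n p s)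
    (hM : 0 < M) (hxK : xK ∈ K) (hxM : h.weightedLen p φ xK (s xK) = M)
    (hmax : h.SatisfiesMaxPrinciple W K φ) : ∃ x ∈ W, M / 2 ≤ h.weightedLen p φ x (s x) := by
  have hp0 : (0 : ℝ) < p := by exact_mod_cast hp
  have hpos : 0 < h.powerLen p xK (s xK) := by
    rw [h.powerLen_eq_weightedLen_mul p φ, hxM]
    positivity
  have key := hmax.2 _ (h.isOmegaPSH_log_powerLen hp hs hpos
    (k := (M⁻¹) ^ (1 / (p : ℝ))) (by positivity))
  set ψ : X → EReal := fun y => ENNReal.log (ENNReal.ofReal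
    ((M⁻¹) ^ (1 / (p : ℝ)) * h.powerLen p y (s y) ^ (1 / (p : ℝ)))) with hψ
  have hlog : 0 < Real.log 2 / p := div_pos (Real.log_pos one_lt_two) hp0
  have hlt : ∀ x (b : ℝ), ((b : EReal) < ψ x - (φ x : EReal)) ↔
      M * Real.exp (p * (b + φ x)) < h.powerLen p x (s x) := by
    intro x b
    rw [EReal.lt_sub_iff_add_lt (Or.inl (EReal.coe_ne_bot _)) (Or.inl (EReal.coe_ne_top _)),
      ← EReal.coe_add, ← not_le, ← not_le, hψ,
      log_normalized_root_le_iff hM (h.powerLen_nonneg _ _ _) hp]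
  have h1 : ((-(Real.log 2 / p) : ℝ) : EReal) < ⨆ x ∈ W, (ψ x - (φ x : EReal)) := by
    rw [← key, lt_biSup_iff]
    refine ⟨xK, hxK, ?_⟩
    rw [hlt, h.powerLen_eq_weightedLen_mul p φ, hxM]
    gcongr
    linarith
  obtain ⟨x, hx, hx2⟩ := lt_biSup_iff.1 h1
  rw [hlt, h.powerLen_eq_weightedLen_mul p φ, mul_add, Real.exp_add, ← mul_assoc] at hx2
  have h3 : Real.exp (p * -(Real.log 2 / p)) = 1 / 2 := by
    rw [mul_neg, mul_div_cancel₀ _ hp0.ne', Real.exp_neg, Real.exp_log two_pos, one_div]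
  rw [h3] at hx2
  refine ⟨x, hx, ?_⟩
  have := lt_of_mul_lt_mul_right hx2 (Real.exp_pos _).le
  linarith

end

omit [VectorBundle ℂ ℂ L] in
theorem abs_sub_le_of_edist_le {f : X → ℝ} {x y : X} {C : ℝ≥0} {α r : ℝ} (hα : 0 < α) (hr : 0 ≤ r)
    (hf : edist (f x) (f y) ≤ C * h.rdist x y ^ α) (hxy : h.rdist x y ≤ ENNReal.ofReal r) :
    |f x - f y| ≤ C * r ^ α := by
  have h1 : edist (f x) (f y) ≤ ENNReal.ofReal (C * r ^ α) := by
    rw [ENNReal.ofReal_mul C.coe_nonneg, ENNReal.ofReal_coe_nnreal,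
      ← ENNReal.ofReal_rpow_of_nonneg hr hα.le]
    exact hf.trans (by gcongr)
  rwa [edist_dist, ENNReal.ofReal_le_ofReal_iff (by positivity), Real.dist_eq] at h1

/-- A holomorphic section which is controlled by a Hölder weight stays comparable to its maximum on
balls of polynomially small radius. -/
theorem exists_weightedLen_lower_bound_near [T2Space X] [IsManifold 𝓘(ℂ, ComplexModel n) ω X]
    [ContMDiffVectorBundle ω ℂ L 𝓘(ℂ, ComplexModel n)] (hpos : h.IsPositive)
    {K : Set X} {φ g : X → ℝ} {Cg Cφ : ℝ≥0} {α β N : ℝ} (hα : 0 < α) (hα1 : α ≤ 1) (hβ : 0 < β)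
    (hN : 0 < N) (hNα : 1 ≤ N * α) (hNβ : 1 ≤ N * β)
    (hg : ∀ x y, edist (g x) (g y) ≤ Cg * h.rdist x y ^ α)
    (hφ : ∀ x ∈ K, ∀ y ∈ K, edist (φ x) (φ y) ≤ Cφ * h.rdist x y ^ β)
    (hgφ : ∀ x ∈ K, g x ≤ φ x) (x₀ : X) :
    ∃ U ∈ 𝓝 x₀, ∃ c : ℝ, 0 < c ∧ c < 1 ∧ ∀ p : ℕ, 1 ≤ p → ∀ s : ∀ x, ⨂[ℂ]^p (L x),
      IsHolomorphicSection n p s → ∀ M : ℝ, 0 < M →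
      (∀ z, h.powerLen p z (s z) ≤ M * Real.exp (p * g z)) →
      ∀ x ∈ K, x ∈ U → M / 2 ≤ h.weightedLen p φ x (s x) →
      ∀ y ∈ K, y ∈ h.rball x (c * (p : ℝ) ^ (-N)) → c * M ≤ h.weightedLen p φ y (s y) := by
  obtain ⟨C, R, hC, hR0, hR1, hB, hcomp, hrball⟩ := h.exists_chart_comparison hpos x₀
  set e := chartAt (ComplexModel n) x₀ with he
  have hxs : x₀ ∈ e.source := mem_chart_source (ComplexModel n) x₀
  -- `D₁` bounds the exponent's oscillation due to `g` and the local weight, `D₂` the one due to `φ`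
  -- and the local weight.
  set D₁ : ℝ := Cg * C + C with hD₁
  set D₂ : ℝ := Cφ + C with hD₂
  have hD₁0 : 0 ≤ D₁ := by positivity
  have hD₂0 : 0 ≤ D₂ := by positivity
  -- Chosen so that the Schwarz bound on the ball of radius `η * t` is half of the lower bound for
  -- `|F a|`.
  set η : ℝ := Real.exp (-D₁) / 8 with hη
  have hη0 : 0 < η := by positivity
  have hη1 : η < 1 := by
    have : Real.exp (-D₁) ≤ 1 := Real.exp_le_one_iff.2 (by linarith)
    rw [hη]
    linarith
  -- With `c₁` a Riemannian ball of radius `c₁ * p ^ (-N)` fits into the chart ball of radius `η * t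
  -- / 2`. The other term of the minimum defining `c` is the final lower constant.
  set c₁ : ℝ := η * R / (2 * C) with hc₁
  have hc₁0 : 0 < c₁ := by positivity
  set c : ℝ := min c₁ (Real.exp (-D₂) / 4) with hc
  have hc0 : 0 < c := lt_min hc₁0 (by positivity)
  have hc1 : c < 1 := by
    have : Real.exp (-D₂) ≤ 1 := Real.exp_le_one_iff.2 (by linarith)
    have : c ≤ Real.exp (-D₂) / 4 := min_le_right _ _
    linarith
  refine ⟨e.source ∩ e ⁻¹' Metric.ball (e x₀) R,
    (e.continuousOn.isOpen_inter_preimage e.open_source Metric.isOpen_ball).mem_nhds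
      ⟨hxs, Metric.mem_ball_self hR0⟩, c, hc0, hc1, ?_⟩
  intro p hp s hs M hM hglob x hxK hxU hxM y hyK hy
  obtain ⟨hxe, hxB⟩ := hxU
  have hxB : e x ∈ Metric.ball (e x₀) R := hxB
  have hp1 : (1 : ℝ) ≤ p := by exact_mod_cast hp
  have hp0 : (0 : ℝ) < p := by linarith
  set t : ℝ := R * (p : ℝ) ^ (-N) with ht
  have hpN0 : 0 < (p : ℝ) ^ (-N) := by positivity
  have hpN1 : (p : ℝ) ^ (-N) ≤ 1 := Real.rpow_le_one_of_one_le_of_nonpos hp1 (by linarith)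
  have ht0 : 0 < t := by positivity
  have htR : t ≤ R := mul_le_of_le_one_right hR0.le hpN1
  have ht1 : t ≤ 1 := htR.trans hR1
  have hpα : p * t ^ α ≤ 1 := mul_rpow_neg_rpow_le_one hR0.le hR1 hα hNα hp1
  have hpβ : p * t ^ β ≤ 1 := mul_rpow_neg_rpow_le_one hR0.le hR1 hβ hNβ hp1
  have hpt : p * t ≤ 1 := by
    refine le_trans ?_ hpα
    gcongr
    exact Real.self_le_rpow_of_le_one ht0.le ht1 hα1
  set a := e x with ha
  have hea : e.symm a = x := e.left_inv hxe
  have hball : ∀ w ∈ Metric.ball a t, w ∈ Metric.closedBall (e x₀) (2 * R) := by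
    intro w hw
    rw [Metric.mem_ball] at hw hxB
    rw [Metric.mem_closedBall]
    linarith [dist_triangle w a (e x₀)]
  have haB := hball a (Metric.mem_ball_self ht0)
  set u : ComplexModel n → ℝ := fun w => h.localWeight x₀ (e.symm w) with hu
  set F : ComplexModel n → ℂ := fun w => powerCoord x₀ (e.symm w) p (s (e.symm w)) with hF
  have hFnorm : ∀ w ∈ Metric.ball a t,
      ‖F w‖ = h.powerLen p (e.symm w) (s (e.symm w)) * Real.exp (p * u w) := by
    intro w hw
    rw [h.powerLen_eq (hB w (hball w hw)).2, mul_assoc, ← Real.exp_add, neg_add_cancel,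
      Real.exp_zero, mul_one]
  have hFd : DifferentiableOn ℂ F (Metric.ball a t) :=
    (differentiableOn_powerCoord_comp_symm hs x₀).mono fun w hw => hB w (hball w hw)
  have hudiff : ∀ w ∈ Metric.ball a t, p * |u w - u a| ≤ C := by
    intro w hw
    have h1 := (hcomp w (hball w hw) a haB).2
    have h2 : dist w a ≤ t := (Metric.mem_ball.1 hw).le
    calc p * |u w - u a| ≤ p * (C * t) := by
          gcongr
          exact h1.trans (by gcongr)
      _ = C * (p * t) := by ring
      _ ≤ C * 1 := by gcongr
      _ = C := mul_one C
  -- `exp (p * G)` converts the weighted length at `x` into the modulus of `F` at `a`, so both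
  -- bounds on `F` are expressed through it.
  set G : ℝ := φ x + u a with hG
  have hFle : ∀ w ∈ Metric.ball a t, ‖F w‖ ≤ M * Real.exp (p * G + D₁) := by
    intro w hw
    have h2 : dist w a ≤ t := (Metric.mem_ball.1 hw).le
    have hrd : h.rdist (e.symm w) x ≤ ENNReal.ofReal (C * t) := by
      have h1 := (hcomp w (hball w hw) a haB).1
      rw [hea] at h1
      exact h1.trans (ENNReal.ofReal_le_ofReal (by gcongr))
    have h3 := h.abs_sub_le_of_edist_le hα (by positivity) (hg _ _) hrd
    have h4 : p * |g (e.symm w) - g x| ≤ Cg * C := by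
      have h5 : (C * t) ^ α ≤ C * t ^ α := by
        rw [Real.mul_rpow (by linarith) ht0.le]
        gcongr
        exact Real.rpow_le_self_of_one_le hC hα1
      calc p * |g (e.symm w) - g x| ≤ p * (Cg * (C * t ^ α)) := by
            gcongr
            exact h3.trans (by gcongr)
        _ = Cg * C * (p * t ^ α) := by ring
        _ ≤ Cg * C * 1 := by gcongr
        _ = Cg * C := mul_one _
    have h6 := hudiff w hw
    rw [hFnorm w hw]
    calc h.powerLen p (e.symm w) (s (e.symm w)) * Real.exp (p * u w)
        ≤ M * Real.exp (p * g (e.symm w)) * Real.exp (p * u w) := by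
          gcongr
          exact hglob _
      _ = M * Real.exp (p * g (e.symm w) + p * u w) := by rw [mul_assoc, ← Real.exp_add]
      _ ≤ M * Real.exp (p * G + D₁) := by
          refine mul_le_mul_of_nonneg_left (Real.exp_le_exp.2 ?_) hM.le
          have h7 : p * (g (e.symm w) - g x) ≤ Cg * C :=
            (mul_le_mul_of_nonneg_left (le_abs_self _) hp0.le).trans h4
          have h8 : p * (u w - u a) ≤ C :=
            (mul_le_mul_of_nonneg_left (le_abs_self _) hp0.le).trans h6
          have h9 : p * g x ≤ p * φ x := mul_le_mul_of_nonneg_left (hgφ x hxK) hp0.le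
          rw [hG, hD₁]
          linarith
  set Q : ℝ := M * Real.exp (p * G + D₁) with hQ
  have hmaps : MapsTo F (Metric.ball a t) (Metric.closedBall (F a) (2 * Q)) := by
    intro w hw
    rw [Metric.mem_closedBall, dist_eq_norm]
    linarith [norm_sub_le (F w) (F a), hFle w hw, hFle a (Metric.mem_ball_self ht0)]
  have hFa : M / 2 * Real.exp (p * G) ≤ ‖F a‖ := by
    rw [hFnorm a (Metric.mem_ball_self ht0), hea, h.powerLen_eq_weightedLen_mul p φ, mul_assoc,
      ← Real.exp_add, hG, mul_add]
    gcongr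
  have hr0 : 0 < c * (p : ℝ) ^ (-N) := by positivity
  have hCr : C * (c * (p : ℝ) ^ (-N)) ≤ η * t / 2 := by
    calc C * (c * (p : ℝ) ^ (-N)) ≤ C * (c₁ * (p : ℝ) ^ (-N)) := by
          gcongr
          exact min_le_left _ _
      _ = η * t / 2 := by rw [hc₁, ht]; field_simp
  have hηt : η * t < t := mul_lt_of_lt_one_left ht0 hη1
  have hrt : c * (p : ℝ) ^ (-N) ≤ t := by
    have : c * (p : ℝ) ^ (-N) ≤ C * (c * (p : ℝ) ^ (-N)) := le_mul_of_one_le_left hr0.le hC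
    have : 0 < η * t := by positivity
    linarith
  obtain ⟨hye, hyd⟩ := hrball x hxe hxB _ hr0 (by
    have : 0 < η * t := by positivity
    linarith) y hy
  have hyd' : dist (e y) a ≤ η * t := by
    have : 0 < η * t := by positivity
    linarith
  have hyb : e y ∈ Metric.ball a t := Metric.mem_ball.2 (by linarith)
  have hey : e.symm (e y) = y := e.left_inv hye
  -- Schwarz lemma in several variables, for the ball of radius `t` mapped into a ball of radius `2
  -- * Q`.
  have hschwarz := Complex.dist_le_div_mul_dist_of_mapsTo_ball hFd hmaps hyb
  have hFdiff : dist (F (e y)) (F a) ≤ M / 4 * Real.exp (p * G) := by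
    calc dist (F (e y)) (F a) ≤ 2 * Q / t * dist (e y) a := hschwarz
      _ ≤ 2 * Q / t * (η * t) := by gcongr
      _ = M / 4 * Real.exp (p * G) * (Real.exp D₁ * Real.exp (-D₁)) := by
          rw [hQ, hη, Real.exp_add]
          field_simp
          ring
      _ = M / 4 * Real.exp (p * G) := by rw [← Real.exp_add, add_neg_cancel, Real.exp_zero, mul_one]
  have hFy : M / 4 * Real.exp (p * G) ≤ ‖F (e y)‖ := by
    have h1 := norm_sub_norm_le (F a) (F (e y))
    rw [← dist_eq_norm, dist_comm] at h1
    linarith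
  rw [hFnorm _ hyb, hey, h.powerLen_eq_weightedLen_mul p φ, mul_assoc, ← Real.exp_add] at hFy
  have hφd : p * |φ x - φ y| ≤ Cφ := by
    have h1 := h.abs_sub_le_of_edist_le hβ ht0.le (hφ x hxK y hyK)
      ((le_of_lt hy).trans (ENNReal.ofReal_le_ofReal hrt))
    calc p * |φ x - φ y| ≤ p * (Cφ * t ^ β) := by gcongr
      _ = Cφ * (p * t ^ β) := by ring
      _ ≤ Cφ * 1 := by gcongr
      _ = Cφ := mul_one _
  -- Returns from the weights at `x` to those at `y`, at the cost of the factor `exp (-D₂)`.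
  have hexp : Real.exp (-D₂) * Real.exp (p * φ y + p * u (e y)) ≤ Real.exp (p * G) := by
    rw [← Real.exp_add]
    refine Real.exp_le_exp.2 ?_
    have h7 : p * -(φ x - φ y) ≤ Cφ :=
      (mul_le_mul_of_nonneg_left (neg_le_abs _) hp0.le).trans hφd
    have h8 : p * (u (e y) - u a) ≤ C :=
      (mul_le_mul_of_nonneg_left (le_abs_self _) hp0.le).trans (hudiff _ hyb)
    rw [hG, hD₂]
    linarith
  have hfin : Real.exp (-D₂) / 4 * M ≤ h.weightedLen p φ y (s y) := by
    refine le_of_mul_le_mul_right (hFy.trans' ?_) (Real.exp_pos (p * φ y + p * u (e y)))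
    calc Real.exp (-D₂) / 4 * M * Real.exp (p * φ y + p * u (e y))
        = M / 4 * (Real.exp (-D₂) * Real.exp (p * φ y + p * u (e y))) := by ring
      _ ≤ M / 4 * Real.exp (p * G) := by gcongr
  refine le_trans ?_ hfin
  gcongr
  exact min_le_right _ _

/-- Decreasing `c` shrinks the ball and weakens the bound, so the minimum over finitely many
neighbourhoods covering `X` serves everywhere. -/
theorem exists_weightedLen_lower_bound [T2Space X] [CompactSpace X]
    [IsManifold 𝓘(ℂ, ComplexModel n) ω X]
    [ContMDiffVectorBundle ω ℂ L 𝓘(ℂ, ComplexModel n)] (hpos : h.IsPositive)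
    {K : Set X} {φ g : X → ℝ} {Cg Cφ : ℝ≥0} {α β N : ℝ} (hα : 0 < α) (hα1 : α ≤ 1) (hβ : 0 < β)
    (hN : 0 < N) (hNα : 1 ≤ N * α) (hNβ : 1 ≤ N * β)
    (hg : ∀ x y, edist (g x) (g y) ≤ Cg * h.rdist x y ^ α)
    (hφ : ∀ x ∈ K, ∀ y ∈ K, edist (φ x) (φ y) ≤ Cφ * h.rdist x y ^ β)
    (hgφ : ∀ x ∈ K, g x ≤ φ x) :
    ∃ c : ℝ, 0 < c ∧ c < 1 ∧ ∀ p : ℕ, 1 ≤ p → ∀ s : ∀ x, ⨂[ℂ]^p (L x),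
      IsHolomorphicSection n p s → ∀ M : ℝ, 0 < M →
      (∀ z, h.powerLen p z (s z) ≤ M * Real.exp (p * g z)) →
      ∀ x ∈ K, M / 2 ≤ h.weightedLen p φ x (s x) →
      ∀ y ∈ K, y ∈ h.rball x (c * (p : ℝ) ^ (-N)) → c * M ≤ h.weightedLen p φ y (s y) := by
  have hmono : ∀ {c c' M b : ℝ} {p : ℕ} {x y : X}, c ≤ c' → 0 < M →
      (y ∈ h.rball x (c' * (p : ℝ) ^ (-N)) → c' * M ≤ b) →
      y ∈ h.rball x (c * (p : ℝ) ^ (-N)) → c * M ≤ b := by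
    intro c c' M b p x y hcc hM hI hy
    refine le_trans (by gcongr) (hI (lt_of_lt_of_le hy (ENNReal.ofReal_le_ofReal ?_)))
    gcongr
  have key := isCompact_univ.induction_on (X := X) (p := fun U =>
    ∃ c : ℝ, 0 < c ∧ c < 1 ∧ ∀ p : ℕ, 1 ≤ p → ∀ s : ∀ x, ⨂[ℂ]^p (L x),
      IsHolomorphicSection n p s → ∀ M : ℝ, 0 < M →
      (∀ z, h.powerLen p z (s z) ≤ M * Real.exp (p * g z)) →
      ∀ x ∈ K, x ∈ U → M / 2 ≤ h.weightedLen p φ x (s x) →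
      ∀ y ∈ K, y ∈ h.rball x (c * (p : ℝ) ^ (-N)) → c * M ≤ h.weightedLen p φ y (s y))
    ⟨1 / 2, by norm_num, by norm_num, by simp⟩
    (fun S T hST ⟨c, hc, hc1, H⟩ => ⟨c, hc, hc1, fun p hp s hs M hM hz x hx hxS =>
      H p hp s hs M hM hz x hx (hST hxS)⟩)
    (fun S T ⟨c, hc, hc1, H⟩ ⟨c', hc', hc1', H'⟩ => ⟨min c c', lt_min hc hc',
      (min_le_left _ _).trans_lt hc1, fun p hp s hs M hM hz x hx hxS hxM y hy => by
        rcases hxS with hxS | hxS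
        · exact hmono (min_le_left _ _) hM (H p hp s hs M hM hz x hx hxS hxM y hy)
        · exact hmono (min_le_right _ _) hM (H' p hp s hs M hM hz x hx hxS hxM y hy)⟩)
    (fun x₀ _ => by
      obtain ⟨U, hU, H⟩ := h.exists_weightedLen_lower_bound_near hpos hα hα1 hβ hN hNα hNβ hg hφ hgφ x₀
      exact ⟨U, mem_nhdsWithin_of_mem_nhds hU, H⟩)
  obtain ⟨c, hc, hc1, H⟩ := key
  exact ⟨c, hc, hc1, fun p hp s hs M hM hz x hx => H p hp s hs M hM hz x hx (mem_univ x)⟩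

/-- A lower bound of a section on a set of known measure bounds its `L²` norm from below. -/
theorem ofReal_mul_sqrt_le_l2Norm [T2Space X] [MeasurableSpace X] [BorelSpace X]
    [IsManifold 𝓘(ℂ, ComplexModel n) ω X] {K : Set X} (hK : IsCompact K) {φ : X → ℝ}
    (hφ : ContinuousOn φ K) {μ : Measure X} (hμK : μ Kᶜ = 0) {p : ℕ} {s : ∀ x, ⨂[ℂ]^p (L x)}
    (hs : IsHolomorphicSection n p s) {B : Set X} {b m : ℝ} (hb : 0 ≤ b) (hm : 0 ≤ m)
    (hB : ∀ y ∈ K, y ∈ B → b ≤ h.weightedLen p φ y (s y)) (hμB : ENNReal.ofReal m ≤ μ B) :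
    ENNReal.ofReal (b * Real.sqrt m) ≤ h.l2Norm p K φ μ s := by
  have hcont : ContinuousOn (fun x => h.weightedLen p φ x (s x)) K :=
    (h.continuous_powerLen hs).continuousOn.mul
      (Real.continuous_exp.comp_continuousOn (continuousOn_const.mul hφ).neg)
  have hmeas : AEStronglyMeasurable (fun x => h.weightedLen p φ x (s x)) (μ.restrict K) :=
    hcont.aestronglyMeasurable hK.measurableSet
  -- Chebyshev's inequality at level `b` with exponent `2`.
  have h1 := mul_meas_ge_le_pow_eLpNorm' (μ.restrict K) (p := 2) (by norm_num) (by norm_num) hmeas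
    (ENNReal.ofReal b)
  have h2 : μ B ≤ (μ.restrict K) {x | ENNReal.ofReal b ≤ ‖h.weightedLen p φ x (s x)‖ₑ} := by
    -- The set `B` need not lie in `K`, but all its mass does.
    rw [Measure.restrict_apply' hK.measurableSet, ← measure_inter_conull hμK (s := B)]
    refine measure_mono fun y hy => ⟨?_, hy.2⟩
    rw [mem_ofPred_eq, Real.enorm_eq_ofReal_abs]
    exact ENNReal.ofReal_le_ofReal ((hB y hy.2 hy.1).trans (le_abs_self _))
  have h3 : ENNReal.ofReal (b * Real.sqrt m) ^ 2 ≤ h.l2Norm p K φ μ s ^ 2 := by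
    have h4 : ENNReal.ofReal b ^ 2 * ENNReal.ofReal m ≤ h.l2Norm p K φ μ s ^ 2 := by
      have h5 : ENNReal.ofReal b ^ 2 * ENNReal.ofReal m ≤
          ENNReal.ofReal b ^ 2 *
            (μ.restrict K) {x | ENNReal.ofReal b ≤ ‖h.weightedLen p φ x (s x)‖ₑ} := by
        gcongr
        exact hμB.trans h2
      refine h5.trans ?_
      simpa [l2Norm] using h1
    rwa [← ENNReal.ofReal_pow (by positivity), mul_pow, Real.sq_sqrt hm,
      ENNReal.ofReal_mul (by positivity), ENNReal.ofReal_pow hb]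
  exact (ENNReal.pow_le_pow_left_iff two_ne_zero).1 h3

end SmoothHermitianMetric

end LineBundle

/-! ### Conclusion -/

theorem theorem2p9
    {n : ℕ} {X : Type*} [TopologicalSpace X] [T2Space X] [CompactSpace X]
    [ChartedSpace (ComplexModel n) X] [IsManifold 𝓘(ℂ, ComplexModel n) ω X]
    [MeasurableSpace X] [BorelSpace X]
    {L : X → Type*} [TopologicalSpace (TotalSpace ℂ L)] [∀ x, TopologicalSpace (L x)]
    [∀ x, AddCommGroup (L x)] [∀ x, Module ℂ (L x)] [FiberBundle ℂ L] [VectorBundle ℂ ℂ L]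
    [ContMDiffVectorBundle ω ℂ L 𝓘(ℂ, ComplexModel n)]
    (h₀ : SmoothHermitianMetric n L) (hpos : h₀.IsPositive)
    (K : Set X) (hK : IsCompact K) (φ : X → ℝ) (hφ : ContinuousOn φ K)
    (μ : Measure X) [IsProbabilityMeasure μ] (hμK : μ Kᶜ = 0)
    (W : Set X) (hW : IsCompact W)
    (δ : ℝ) (hδ₀ : 0 < δ) (hδ₁ : δ < 1)
    (hreg : h₀.IsRegularPair K φ)
    (hφHolder : h₀.IsHolderOn φ K)
    (hPHolder : ∃ g : X → ℝ, (∀ x, h₀.equilibriumWeight K φ x = (g x : EReal)) ∧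
      h₀.IsHolderOn g univ)
    (hmax : h₀.SatisfiesMaxPrinciple W K φ)
    (hmass : h₀.MassDensity μ W) :
    h₀.IsBernsteinMarkov δ K φ μ := by
  obtain ⟨g, hgP, Cg, α, hα, hα1, hg⟩ := hPHolder
  obtain ⟨Cφ, β, hβ, hβ1, hφH⟩ := hφHolder
  obtain ⟨c₀, ρ, hc₀, hρ, hmass⟩ := hmass
  -- Regularity enters here: the envelope itself, not just its regularization, is the Hölder
  -- function `g`, so `g ≤ φ` holds at every point of `K`.
  have hgE : ∀ z, h₀.envelope K φ z = (g z : EReal) := fun z => (hreg z).symm.trans (hgP z)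
  have hgφ : ∀ x ∈ K, g x ≤ φ x := fun x hx => by
    have := h₀.envelope_le (φ := φ) hx
    rwa [hgE, EReal.coe_le_coe_iff] at this
  set N : ℝ := 1 / α + 1 / β with hN
  have hN0 : 0 < N := by positivity
  have hNα : 1 ≤ N * α := by
    have : N * α = 1 + α / β := by rw [hN]; field_simp
    have : 0 < α / β := by positivity
    linarith
  have hNβ : 1 ≤ N * β := by
    have : N * β = 1 + β / α := by rw [hN]; field_simp; ring
    have : 0 < β / α := by positivity
    linarith
  obtain ⟨c, hc, hc1, H⟩ := h₀.exists_weightedLen_lower_bound hpos hα hα1 hβ hN0 hNα hNβ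
    (fun x y => hg x (mem_univ x) y (mem_univ y)) hφH hgφ
  -- The ball of radius `c * p ^ (-N)` has mass at least `c₀ * c ^ ρ * p ^ (-N * ρ)`; the square
  -- root of the mass gives `A₁` and the exponent `N * ρ / 2`.
  set A₁ : ℝ := (c * Real.sqrt (c₀ * c ^ ρ))⁻¹ with hA₁
  have hA₁0 : 0 < A₁ := by positivity
  set N' : ℝ := N * ρ / 2 with hN'
  have hN'0 : 0 ≤ N' := by positivity
  have hδ : 0 < 1 - δ := sub_pos.2 hδ₁
  -- The first term dominates the prefactor; the second dominates the exponent that absorbs `p ^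
  -- N'`.
  set A : ℝ := A₁ + N' / (1 - δ) with hA
  have hAN : 0 ≤ N' / (1 - δ) := by positivity
  refine ⟨A, by positivity, fun p hp s hs => ?_⟩
  have hp1 : (1 : ℝ) ≤ p := by exact_mod_cast hp
  have hp0 : (0 : ℝ) < p := by linarith
  rcases K.eq_empty_or_nonempty with rfl | hKne
  · simp [SmoothHermitianMetric.supNorm]
  have hcont : ContinuousOn (fun x => h₀.weightedLen p φ x (s x)) K :=
    (h₀.continuous_powerLen hs).continuousOn.mul
      (Real.continuous_exp.comp_continuousOn (continuousOn_const.mul hφ).neg)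
  obtain ⟨xK, hxK, hxmax⟩ := hK.exists_isMaxOn hKne hcont
  set M : ℝ := h₀.weightedLen p φ xK (s xK) with hM
  have hle : ∀ x ∈ K, h₀.weightedLen p φ x (s x) ≤ M := fun x hx => hxmax hx
  have hsup : h₀.supNorm p K φ s ≤ ENNReal.ofReal M :=
    iSup₂_le fun x hx => ENNReal.ofReal_le_ofReal (hle x hx)
  refine hsup.trans ?_
  rcases (h₀.weightedLen_nonneg p φ xK (s xK)).eq_or_lt with hM0 | hM0
  · rw [hM, ← hM0]
    simp
  obtain ⟨x, hxW, hx⟩ := h₀.exists_half_le_weightedLen hp hs hM0 hxK rfl hmax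
  have hglob := h₀.powerLen_le_exp_envelope hp hs hgE hM0 rfl hle
  set r : ℝ := c * (p : ℝ) ^ (-N) with hr
  have hr0 : 0 < r := by positivity
  have hr1 : r < 1 := by
    have : (p : ℝ) ^ (-N) ≤ 1 := Real.rpow_le_one_of_one_le_of_nonpos hp1 (by linarith)
    exact lt_of_le_of_lt (mul_le_of_le_one_right hc.le this) hc1
  have hl2 := h₀.ofReal_mul_sqrt_le_l2Norm hK hφ hμK hs (by positivity) (by positivity)
    (H p hp s hs M hM0 hglob x (hmax.1 hxW) hx) (hmass x hxW r hr0 hr1)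
  have hsqrt : Real.sqrt (c₀ * r ^ ρ) = Real.sqrt (c₀ * c ^ ρ) * ((p : ℝ) ^ N')⁻¹ := by
    have h1 : c₀ * r ^ ρ = c₀ * c ^ ρ * (((p : ℝ) ^ N')⁻¹) ^ 2 := by
      rw [hr, Real.mul_rpow hc.le (by positivity), ← Real.rpow_mul hp0.le, ← Real.rpow_neg hp0.le,
        ← Real.rpow_natCast, ← Real.rpow_mul hp0.le, hN']
      have : -(N * ρ / 2) * ((2 : ℕ) : ℝ) = -N * ρ := by push_cast; ring
      rw [this]
      ring
    rw [h1, Real.sqrt_mul (by positivity), Real.sqrt_sq (by positivity)]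
  have hMeq : M = A₁ * (p : ℝ) ^ N' * (c * M * Real.sqrt (c₀ * r ^ ρ)) := by
    have : 0 < Real.sqrt (c₀ * c ^ ρ) := by positivity
    have : 0 < (p : ℝ) ^ N' := by positivity
    rw [hsqrt, hA₁]
    field_simp
  have hconst : A₁ * (p : ℝ) ^ N' ≤ A * Real.exp (A * (p : ℝ) ^ (1 - δ)) := by
    have h1 := rpow_le_mul_exp_rpow hp1 hN'0 hδ₁
    have h2 : Real.exp (N' / (1 - δ) * (p : ℝ) ^ (1 - δ)) ≤ Real.exp (A * (p : ℝ) ^ (1 - δ)) := by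
      refine Real.exp_le_exp.2 ?_
      gcongr
      linarith
    have h3 : A₁ ≤ A := by linarith
    exact mul_le_mul h3 (h1.trans h2) (by positivity) (by positivity)
  calc ENNReal.ofReal M
      = ENNReal.ofReal (A₁ * (p : ℝ) ^ N') *
          ENNReal.ofReal (c * M * Real.sqrt (c₀ * r ^ ρ)) := by
        rw [← ENNReal.ofReal_mul (by positivity), ← hMeq]
    _ ≤ _ := by gcongr
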